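/- Let $\sigma,\varphi:\mathbb R\to\mathbb R$ be fixed Lipschitz functions with Lipschitz constants $\lambda_\sigma,\lambda_\varphi$ and let $\gamma>0$ be fixed. For every $n\ge 1$ let $p=p(n)$ and $T=T(n)$ be integers, let $X=X(n)\in\mathbb R^{p\times T}$ be deterministic, and let $W=\varphi(\tilde W)$ (entry-wise), where $\tilde W\in\mathbb R^{n\times p}$ has independent $\mathcal N(0,1)$ entries. Assume the proportional growth regime $$0<\liminf_{n}\min\{p/n,\,T/n\}\le\limsup_{n}\max\{p/n,\,T/n\}<\infty,\qquad \limsup_{n}\|X\|<\infty .$$ Let $\Sigma=\sigma(WX)$ (entry-wise), $Q=\left(\frac1T\Sigma^{\mathsf T}\Sigma+\gamma I_T\right)^{-1}$, and $\Phi=\mathbb E\left[\sigma(w^{\mathsf T}X)^{\mathsf T}\sigma(w^{\mathsf T}X)\right]\in\mathbb R^{T\times T}$, where $w=\varphi(\tilde w)$ with $\tilde w\sim\mathcal N(0,I_p)$. For $\delta\ge0$ put $$\bar Q=\bar Q(\delta)=\left(\frac nT\,\frac{\Phi}{1+\delta}+\gamma I_T\right)^{-1}.$$ Then, for every $n\ge1$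 with $\Phi\neq0$, the equation $\delta=\frac1T\operatorname{tr}\Phi\bar Q(\delta)$ has exactly one positive solution $\delta$; if $\Phi=0$, take $\delta=0$. With this $\delta$ and $\bar Q=\bar Q(\delta)$, for every $\varepsilon>0$ there exists $c>0$ (not depending on $n$) such that, for all $n\ge1$, $$\left\|\mathbb E[Q]-\bar Q\right\|\le c\,n^{-\frac12+\varepsilon}.$$ Here $\|\cdot\|$ is the operator norm induced by the Euclidean norms. -/

import Mathlib

open MeasureTheory ProbabilityTheory Filter
open scoped NNReal Matrix Matrix.Norms.L2Operator

namespace RandomFeatures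

/-- The random feature matrix `σ(W X)`, with `σ` applied entry-wise. -/
def featureMatrix {n p T : ℕ} (σ : ℝ → ℝ) (W : Matrix (Fin n) (Fin p) ℝ)
    (X : Matrix (Fin p) (Fin T) ℝ) : Matrix (Fin n) (Fin T) ℝ :=
  (W * X).map σ

/-- The resolvent `((1/T) Sᵀ S + γ I_T)⁻¹` of `(1/T) Sᵀ S`. -/
noncomputable def resolvent {n T : ℕ} (γ : ℝ) (S : Matrix (Fin n) (Fin T) ℝ) :
    Matrix (Fin T) (Fin T) ℝ :=
  ((1 / (T : ℝ)) • (Sᵀ * S) + γ • (1 : Matrix (Fin T) (Fin T) ℝ))⁻¹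

/-- The entry-wise expectation of a random matrix. -/
noncomputable def expectation {Ω : Type*} [MeasurableSpace Ω] {m k : ℕ} (P : Measure Ω)
    (M : Ω → Matrix (Fin m) (Fin k) ℝ) : Matrix (Fin m) (Fin k) ℝ :=
  Matrix.of fun a b => ∫ ω, M ω a b ∂P

/-- The standard Gaussian law `N(0, I_p)` on `ℝ^p`. -/
noncomputable def gaussianVec (p : ℕ) : Measure (Fin p → ℝ) :=
  Measure.pi fun _ => gaussianReal 0 1

/-- The random feature vector `σ(wᵀ X)` with `w = φ(v)`, `φ` and `σ` applied entry-wise. -/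
def featureVec {p T : ℕ} (σ φ : ℝ → ℝ) (X : Matrix (Fin p) (Fin T) ℝ) (v : Fin p → ℝ) :
    Fin T → ℝ :=
  fun a => σ (((fun i => φ (v i)) ᵥ* X) a)

/-- The matrix `Φ = E[σ(wᵀ X)ᵀ σ(wᵀ X)]`, where `w = φ(v)` with `v ~ N(0, I_p)`. -/
noncomputable def Phi {p T : ℕ} (σ φ : ℝ → ℝ) (X : Matrix (Fin p) (Fin T) ℝ) :
    Matrix (Fin T) (Fin T) ℝ :=
  expectation (gaussianVec p) fun v =>
    Matrix.vecMulVec (featureVec σ φ X v) (featureVec σ φ X v)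

/-- The matrix `((n/T) Φ / (1 + δ) + γ I_T)⁻¹`. -/
noncomputable def Qbar {T : ℕ} (n : ℕ) (γ : ℝ) (F : Matrix (Fin T) (Fin T) ℝ) (δ : ℝ) :
    Matrix (Fin T) (Fin T) ℝ :=
  (((n : ℝ) / (T : ℝ) / (1 + δ)) • F + γ • (1 : Matrix (Fin T) (Fin T) ℝ))⁻¹

/-- The fixed-point equation `δ = (1/T) tr (Φ Q̄)`, in which `Q̄` depends on `δ`. -/
def FixedPoint {T : ℕ} (n : ℕ) (γ : ℝ) (F : Matrix (Fin T) (Fin T) ℝ) (δ : ℝ) : Prop :=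
  δ = 1 / (T : ℝ) * (F * Qbar n γ F δ).trace

/-- The proportional growth regime, for dimensions `p = p(n)`, `T = T(n)` and data matrices
`X = X(n)`: `0 < liminf min(p/n, T/n)`, `limsup max(p/n, T/n) < ∞` and `limsup ‖X‖ < ∞`,
where `‖·‖` is the operator norm. Limits are taken in the extended reals. -/
structure GrowthRate (p T : ℕ → ℕ) (X : ∀ n, Matrix (Fin (p n)) (Fin (T n)) ℝ) : Prop where
  liminf_pos : 0 < liminf
    (fun n : ℕ => ((min ((p n : ℝ) / (n : ℝ)) ((T n : ℝ) / (n : ℝ)) : ℝ) : EReal)) atTop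
  limsup_lt_top : limsup
    (fun n : ℕ => ((max ((p n : ℝ) / (n : ℝ)) ((T n : ℝ) / (n : ℝ)) : ℝ) : EReal)) atTop < ⊤
  limsup_norm_lt_top : limsup (fun n : ℕ => ((‖X n‖ : ℝ) : EReal)) atTop < ⊤

/-- `V` is a random `n × p` matrix with independent `N(0, 1)` entries. -/
structure IsGaussianMatrix {Ω : Type*} [MeasurableSpace Ω] {n p : ℕ}
    (V : Ω → Matrix (Fin n) (Fin p) ℝ) (P : Measure Ω) : Prop where
  hasLaw : ∀ i j, HasLaw (fun ω => V ω i j) (gaussianReal 0 1) P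
  indep : iIndepFun (fun (ij : Fin n × Fin p) (ω : Ω) => V ω ij.1 ij.2) P

end RandomFeatures

/-!
The theorem is a leave-one-out argument driven by dimension-free Gaussian concentration.

**Concentration.** Write `g, g'` for independent standard Gaussian vectors. Rotating `g` into `g'`
along the arc `cos θ g + sin θ g'` preserves the joint law of position and velocity, so the
increment `f g' - f g` of an `L`-Lipschitz function is an average along the arc of variables that,
given the position, are Gaussian of standard deviation at most `(π / 2) L`. Hence the `p`-th central
moment of `f g` is at most `concConst p * L ^ p` in every dimension (`integral_sub_mean_pow_le`).
Only the fourth and eighth moments are used. The Lipschitz inputs are these: a row `s = σ(wᵀ X)` of `Σ` is a Lipschitz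
image of a Gaussian vector (`lipschitzWith_featureMap`), and the resolvent of a Gram matrix is a
Lipschitz function of the rows with constant of order `T ^ (-1/2)` (`norm_reg_gram_sub_le`).

**The quadratic forms of the rows.** Let `Q₋` be the resolvent without the `i`-th row `s`. The form
`d = (1/T) sᵀ Q₋ s` is concentrated around its mean `α = (1/T) tr (Φ E[Q₋])`, with fourth central
moment of order `T ^ (-2)` (`integral_rowForm_sub_pow_four_le`). Given `Q₋`, it is the square of
the Lipschitz function `‖Q₋^{1/2} s‖ / √T` of a Gaussian vector.

**The expected resolvent.** Let `Q̃ = Q̄(α)` and `κ = (n/T) / (1 + α)`. Exchangeability of the rows,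
the resolvent identity and the Sherman-Morrison relation `Q₋ s = (1 + d) Q s` give
`E[Q] - Q̃ = κ (E[Q] - E[Q₋]) Φ Q̃ + κ E[(d - α) Q s sᵀ Q̃]`.
Both terms are of order `n ^ (-1/2)`. The first one is bounded with `‖κ Φ Q̃‖ ≤ 1` and with the
rank-one formula for `Q₋ - Q` (`norm_expectation_looRes_sub_fullRes_le`). For the second one,
Cauchy-Schwarz is applied twice: the second moment of `uᵀ Q s` is bounded because the sum over all
rows is, and the fourth moment of `sᵀ Q̃ v` is bounded by concentration
(`norm_expectation_fullRes_sub_Qbar_le`).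

**From `α` to `δ`.** The parameter `α` solves the fixed-point equation up to `O(n ^ (-1/2))`. The map
`δ ↦ (1/T) tr (Φ Q̄(δ))` is nondecreasing, and its difference quotients based at a fixed point `δ`
are at most `δ / (1 + δ) < 1` (`exists_traceMap_sub_eq`). This yields existence and uniqueness of
the positive solution, and stability: `‖Q̄(α) - Q̄(δ)‖` is controlled by the defect of `α`
(`norm_Qbar_sub_Qbar_le`). The result is a bound with an explicit constant depending only on `γ` and
on bounds for `n / T`, for `tr Φ / T` and for the Lipschitz constant of the rows
(`norm_expectation_fullRes_sub_Qbar_fixedPoint_le`). The growth assumption bounds these for large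
`n`, and the finitely many other values of `n` only affect the constant.
-/

/-! ### Concentration of Lipschitz functions of Gaussian vectors -/

section GaussianConcentration

theorem pi_absolutelyContinuous_fin {m : ℕ} (μ ν : Measure ℝ) [SigmaFinite μ] [SigmaFinite ν]
    (h : μ ≪ ν) : (Measure.pi fun _ : Fin m => μ) ≪ Measure.pi fun _ : Fin m => ν := by
  induction m with
  | zero => rw [Measure.pi_of_empty, Measure.pi_of_empty]
  | succ m ih =>
    have h1 := (measurePreserving_piFinSuccAbove (fun _ : Fin (m + 1) => μ) 0).symm
    have h2 := (measurePreserving_piFinSuccAbove (fun _ : Fin (m + 1) => ν) 0).symm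
    rw [← h1.map_eq, ← h2.map_eq]
    exact (h.prod ih).map (MeasurableEquiv.measurable _)

section Arc

variable {E : Type*} [NormedAddCommGroup E] [InnerProductSpace ℝ E]

/-- The arc `cos θ x + sin θ y`, `θ = π t / 2`, from `x` at time `0` to `y` at time `1`. -/
noncomputable def arc (x y : E) (t : ℝ) : E :=
  Real.cos (Real.pi / 2 * t) • x + Real.sin (Real.pi / 2 * t) • y

/-- The velocity of `arc x y`, up to the factor `π / 2`. -/
noncomputable def arcVelocity (x y : E) (t : ℝ) : E :=
  -Real.sin (Real.pi / 2 * t) • x + Real.cos (Real.pi / 2 * t) • y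

theorem hasDerivAt_arc (x y : E) (t : ℝ) :
    HasDerivAt (arc x y) ((Real.pi / 2) • arcVelocity x y t) t := by
  have h0 : HasDerivAt (fun t : ℝ => Real.pi / 2 * t) (Real.pi / 2) t := by
    simpa using (hasDerivAt_id t).const_mul (Real.pi / 2)
  have h1 := (h0.cos.smul_const x).add (h0.sin.smul_const y)
  refine h1.congr_deriv ?_
  rw [arcVelocity, smul_add, smul_smul, smul_smul]
  congr 2 <;> ring

/-- A Lipschitz function is absolutely continuous along the arc, so its increment is the integral of
its derivative. Jensen's inequality then bounds the even powers. -/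
theorem ofReal_pow_sub_le_lintegral_deriv_arc {f : E → ℝ} {L : ℝ≥0} (hf : LipschitzWith L f) {p : ℕ}
    (hp : Even p) (x y : E) :
    ENNReal.ofReal ((f y - f x) ^ p) ≤
      ∫⁻ t in Set.Ioc (0 : ℝ) 1, ENNReal.ofReal ((deriv (fun t => f (arc x y t)) t) ^ p) := by
  obtain ⟨C, hC⟩ : ∃ C, LipschitzOnWith C (arc x y) (Set.uIcc 0 1) := by
    have hd : ContDiff ℝ 1 (arc x y) := by
      unfold arc
      fun_prop
    exact hd.contDiffOn.exists_lipschitzOnWith (by decide) (convex_uIcc _ _) isCompact_uIcc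
  have hac : AbsolutelyContinuousOnInterval (fun t => f (arc x y t)) 0 1 :=
    (hf.comp_lipschitzOnWith hC).absolutelyContinuousOnInterval
  have hftc := hac.integral_deriv_eq_sub
  have h0 : arc x y 0 = x := by simp [arc]
  have h1 : arc x y 1 = y := by simp [arc]
  have hint := hac.intervalIntegrable_deriv
  rw [intervalIntegral.integral_of_le zero_le_one, h0, h1] at hftc
  rw [intervalIntegrable_iff_integrableOn_Ioc_of_le zero_le_one] at hint
  rw [← hftc]
  have : IsProbabilityMeasure (volume.restrict (Set.Ioc (0 : ℝ) 1)) := ⟨by simp⟩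
  -- the derivative is bounded, so its powers are integrable
  obtain ⟨D, hD⟩ : ∃ D, ∀ t ∈ Set.Ioo (0 : ℝ) 1, ‖deriv (fun t => f (arc x y t)) t‖ ≤ D := by
    refine ⟨L * C, fun t ht => ?_⟩
    rw [Set.uIcc_of_le zero_le_one] at hC
    simpa [Function.comp_def] using norm_deriv_le_of_lipschitzOn (𝕜 := ℝ) (Icc_mem_nhds ht.1 ht.2)
      (hf.comp_lipschitzOnWith hC)
  have hae : ∀ᵐ t ∂(volume.restrict (Set.Ioc (0 : ℝ) 1)),
      ‖deriv (fun t => f (arc x y t)) t ^ p‖ ≤ D ^ p := by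
    rw [← restrict_Ioo_eq_restrict_Ioc, ae_restrict_iff' measurableSet_Ioo]
    refine Eventually.of_forall fun t ht => ?_
    rw [norm_pow]
    exact pow_le_pow_left₀ (norm_nonneg _) (hD t ht) p
  have hint' : Integrable (fun t => deriv (fun t => f (arc x y t)) t ^ p)
      (volume.restrict (Set.Ioc (0 : ℝ) 1)) :=
    Integrable.of_bound ((measurable_deriv _).pow_const p).aestronglyMeasurable _ hae
  rw [← ofReal_integral_eq_lintegral_ofReal hint' (Eventually.of_forall fun t => hp.pow_nonneg _)]
  exact ENNReal.ofReal_le_ofReal (ConvexOn.map_integral_le (g := fun z : ℝ => z ^ p)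
    hp.convexOn_pow (by fun_prop) isClosed_univ (by simp) hint hint')

end Arc

variable {E : Type*} [NormedAddCommGroup E] [InnerProductSpace ℝ E] [FiniteDimensional ℝ E]
  [MeasurableSpace E] [BorelSpace E]

theorem stdGaussian_absolutelyContinuous : stdGaussian E ≪ (volume : Measure E) := by
  have h1 : (Measure.pi fun _ : Fin (Module.finrank ℝ E) => gaussianReal 0 1) ≪
      Measure.pi fun _ : Fin (Module.finrank ℝ E) => (volume : Measure ℝ) :=
    pi_absolutelyContinuous_fin _ _ (gaussianReal_absolutelyContinuous 0 one_ne_zero)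
  have h2 := (EuclideanSpace.volume_preserving_symm_measurableEquiv_toLp
    (Fin (Module.finrank ℝ E))).symm
  have h3 := (stdOrthonormalBasis ℝ E).repr.symm.measurePreserving
  rw [← stdGaussian_map (stdOrthonormalBasis ℝ E).repr.symm, ← map_pi_eq_stdGaussian, ← h3.map_eq]
  refine Measure.AbsolutelyContinuous.map ?_ h3.measurable
  rw [← h2.map_eq]
  exact h1.map h2.measurable

/-- The pair of position and velocity is a rotation of the pair of endpoints, which leaves the law of
two independent standard Gaussian vectors invariant. -/
theorem map_arc_prod (t : ℝ) :
    ((stdGaussian E).prod (stdGaussian E)).map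
      (fun z => (arc z.1 z.2 t, arcVelocity z.1 z.2 t)) =
      (stdGaussian E).prod (stdGaussian E) := by
  have h := IsGaussian.map_rotation_eq_self (μ := stdGaussian E)
    (by simp) (Real.pi / 2 * t)
  convert h using 2
  ext z <;> simp [ContinuousLinearMap.rotation_apply, arc, arcVelocity]

theorem measurePreserving_arc (t : ℝ) :
    MeasurePreserving (fun z : E × E => (arc z.1 z.2 t, arcVelocity z.1 z.2 t))
      ((stdGaussian E).prod (stdGaussian E)) ((stdGaussian E).prod (stdGaussian E)) :=
  ⟨by unfold arc arcVelocity; fun_prop, map_arc_prod t⟩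

/-- The `p`-th absolute moment of `N(0, 1)`. -/
noncomputable def gaussianMoment (p : ℕ) : ℝ := ∫ x, |x| ^ p ∂(gaussianReal 0 1)

theorem gaussianMoment_nonneg (p : ℕ) : 0 ≤ gaussianMoment p :=
  integral_nonneg fun _ => by positivity

/-- A continuous linear functional `ℓ` of a standard Gaussian vector is a centred Gaussian variable of
standard deviation `‖ℓ‖`. -/
theorem lintegral_dual_pow (ℓ : StrongDual ℝ E) (p : ℕ) :
    ∫⁻ y, ENNReal.ofReal (|ℓ y| ^ p) ∂(stdGaussian E) =
      ENNReal.ofReal (‖ℓ‖ ^ p * gaussianMoment p) := by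
  have h1 : (stdGaussian E).map ℓ = (gaussianReal 0 1).map (fun x => ‖ℓ‖ * x) := by
    rw [IsGaussian.map_eq_gaussianReal, gaussianReal_map_const_mul, variance_dual_stdGaussian,
      integral_strongDual_stdGaussian]
    congr 1
    · simp
    · ext; simp
  have hint : Integrable (fun x : ℝ => |x| ^ p) (gaussianReal 0 1) := by
    simpa using (memLp_id_gaussianReal (μ := 0) (v := 1) p).integrable_norm_pow'
  calc ∫⁻ y, ENNReal.ofReal (|ℓ y| ^ p) ∂(stdGaussian E)
      = ∫⁻ z, ENNReal.ofReal (|z| ^ p) ∂((stdGaussian E).map ℓ) := by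
        rw [lintegral_map (by fun_prop) (by fun_prop)]
    _ = ∫⁻ z, ENNReal.ofReal (‖ℓ‖ ^ p * |z| ^ p) ∂(gaussianReal 0 1) := by
        rw [h1, lintegral_map (by fun_prop) (by fun_prop)]
        simp [abs_mul, mul_pow]
    _ = ENNReal.ofReal (‖ℓ‖ ^ p * gaussianMoment p) := by
        rw [gaussianMoment, ← integral_const_mul, ofReal_integral_eq_lintegral_ofReal]
        · exact hint.const_mul _
        · exact Eventually.of_forall fun _ => by positivity

/-- The constant in the bound `concConst p * L ^ p` for the `p`-th central moment of an
`L`-Lipschitz function of a standard Gaussian vector. -/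
noncomputable def concConst (p : ℕ) : ℝ := (Real.pi / 2) ^ p * gaussianMoment p

theorem concConst_nonneg (p : ℕ) : 0 ≤ concConst p :=
  mul_nonneg (by positivity) (gaussianMoment_nonneg p)

/-- The **Maurey-Pisier inequality**, for even moments. Almost everywhere differentiability of `f`
(Rademacher) transfers to almost every point of almost every arc. -/
theorem lintegral_pow_sub_le {f : E → ℝ} {L : ℝ≥0} (hf : LipschitzWith L f) {p : ℕ}
    (hp : Even p) :
    ∫⁻ z, ENNReal.ofReal ((f z.2 - f z.1) ^ p) ∂((stdGaussian E).prod (stdGaussian E)) ≤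
      ENNReal.ofReal (concConst p * L ^ p) := by
  set ν := stdGaussian E with hν
  set I := volume.restrict (Set.Ioc (0 : ℝ) 1) with hI
  have : IsProbabilityMeasure I := ⟨by simp [hI]⟩
  have hA : Continuous fun q : (E × E) × ℝ => arc q.1.1 q.1.2 q.2 := by
    unfold arc; fun_prop
  have hB : Continuous fun q : (E × E) × ℝ => arcVelocity q.1.1 q.1.2 q.2 := by
    unfold arcVelocity; fun_prop
  -- the gradient contribution at time `t`
  let g : E × E → ℝ → ENNReal := fun z t =>
    ENNReal.ofReal (|(Real.pi / 2) * fderiv ℝ f (arc z.1 z.2 t) (arcVelocity z.1 z.2 t)| ^ p)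
  have happ : Measurable fun q : E × E => fderiv ℝ f q.1 q.2 := by
    have h1 : Measurable fun q : E × E => (fderiv ℝ f q.1, q.2) :=
      ((measurable_fderiv ℝ f).comp measurable_fst).prodMk measurable_snd
    have h2 : Continuous fun r : (E →L[ℝ] ℝ) × E => r.1 r.2 := by fun_prop
    exact h2.measurable.comp h1
  have hgm : Measurable (Function.uncurry g) := by
    have h1 : Measurable fun q : (E × E) × ℝ =>
        fderiv ℝ f (arc q.1.1 q.1.2 q.2) (arcVelocity q.1.1 q.1.2 q.2) :=
      happ.comp (hA.measurable.prodMk hB.measurable)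
    simp only [g, Function.uncurry_def]
    fun_prop
  have hdiff : ∀ᵐ x ∂ν, DifferentiableAt ℝ f x :=
    stdGaussian_absolutelyContinuous hf.ae_differentiableAt
  have hdiff2 : ∀ᵐ z ∂(ν.prod ν), ∀ᵐ t ∂I, DifferentiableAt ℝ f (arc z.1 z.2 t) := by
    rw [Measure.ae_ae_comm]
    · refine Eventually.of_forall fun t => ?_
      have h1 : ∀ᵐ z ∂(ν.prod ν), DifferentiableAt ℝ f z.1 :=
        Measure.quasiMeasurePreserving_fst.ae hdiff
      exact (measurePreserving_arc t).quasiMeasurePreserving.ae h1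
    · exact hA.measurable (measurableSet_of_differentiableAt ℝ f)
  have hpt : ∀ᵐ z ∂(ν.prod ν), ENNReal.ofReal ((f z.2 - f z.1) ^ p) ≤ ∫⁻ t, g z t ∂I := by
    filter_upwards [hdiff2] with z hz
    refine (ofReal_pow_sub_le_lintegral_deriv_arc hf hp z.1 z.2).trans ?_
    refine lintegral_mono_ae ?_
    filter_upwards [hz] with t ht
    have hd := ht.hasFDerivAt.comp_hasDerivAt t (hasDerivAt_arc z.1 z.2 t)
    have hd' : deriv (fun t => f (arc z.1 z.2 t)) t =
        (Real.pi / 2) * fderiv ℝ f (arc z.1 z.2 t) (arcVelocity z.1 z.2 t) := by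
      rw [show (fun t => f (arc z.1 z.2 t)) = f ∘ arc z.1 z.2 from rfl, hd.deriv]
      simp
    simp only [g]
    rw [← hd', hp.pow_abs]
  calc _ ≤ ∫⁻ z, ∫⁻ t, g z t ∂I ∂(ν.prod ν) := lintegral_mono_ae hpt
    _ = ∫⁻ t, ∫⁻ z, g z t ∂(ν.prod ν) ∂I := lintegral_lintegral_swap hgm.aemeasurable
    _ ≤ ∫⁻ t, ENNReal.ofReal (concConst p * L ^ p) ∂I := by
        refine lintegral_mono fun t => ?_
        have hG : Measurable fun q : E × E =>
            ENNReal.ofReal (|(Real.pi / 2) * fderiv ℝ f q.1 q.2| ^ p) := by fun_prop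
        rw [show (fun z => g z t) = fun z : E × E => (fun q : E × E =>
            ENNReal.ofReal (|(Real.pi / 2) * fderiv ℝ f q.1 q.2| ^ p))
              (arc z.1 z.2 t, arcVelocity z.1 z.2 t) from rfl,
          (measurePreserving_arc t).lintegral_comp hG, lintegral_prod _ hG.aemeasurable]
        calc _ ≤ ∫⁻ _, ENNReal.ofReal (concConst p * L ^ p) ∂ν := by
              refine lintegral_mono fun x => ?_
              have h1 := lintegral_dual_pow ((Real.pi / 2) • fderiv ℝ f x) p
              simp only [_root_.smul_apply, smul_eq_mul] at h1
              rw [h1]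
              refine ENNReal.ofReal_le_ofReal ?_
              have h2 := norm_fderiv_le_of_lipschitz ℝ (x₀ := x) hf
              rw [norm_smul, mul_pow, Real.norm_of_nonneg (by positivity), concConst]
              have h3 := pow_le_pow_left₀ (norm_nonneg _) h2 p
              have h4 := gaussianMoment_nonneg p
              calc _ = (Real.pi / 2) ^ p * gaussianMoment p * ‖fderiv ℝ f x‖ ^ p := by ring
                _ ≤ _ := by gcongr
          _ = _ := by simp
    _ = _ := by simp

end GaussianConcentration

/-! ### Random variables with finite moments of every order -/

section AllMoments

/-- A real random variable all of whose moments are finite. -/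
def AllMoments {α : Type*} [MeasurableSpace α] (f : α → ℝ) (μ : Measure α) : Prop :=
  ∀ p : ℝ≥0, MemLp f p μ

namespace AllMoments

variable {α : Type*} [MeasurableSpace α] {μ : Measure α} {f g : α → ℝ}

theorem integrable (hf : AllMoments f μ) : Integrable f μ :=
  memLp_one_iff_integrable.1 (by exact_mod_cast hf 1)

theorem add (hf : AllMoments f μ) (hg : AllMoments g μ) : AllMoments (fun x => f x + g x) μ :=
  fun p => (hf p).add (hg p)

theorem sub (hf : AllMoments f μ) (hg : AllMoments g μ) : AllMoments (fun x => f x - g x) μ :=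
  fun p => (hf p).sub (hg p)

theorem mul (hf : AllMoments f μ) (hg : AllMoments g μ) : AllMoments (fun x => f x * g x) μ := by
  intro p
  have : ENNReal.HolderTriple ((2 * p : ℝ≥0) : ENNReal) ((2 * p : ℝ≥0) : ENNReal) (p : ENNReal) := by
    refine ⟨?_⟩
    push_cast
    rw [ENNReal.mul_inv (by simp) (by simp), ← add_mul, ENNReal.inv_two_add_inv_two, one_mul]
  exact (hg (2 * p)).mul (hf (2 * p))

theorem const [IsFiniteMeasure μ] (c : ℝ) : AllMoments (fun _ : α => c) μ :=
  fun _ => memLp_const c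

theorem const_mul (c : ℝ) (hf : AllMoments f μ) : AllMoments (fun x => c * f x) μ :=
  fun p => (hf p).const_mul c

theorem pow [IsFiniteMeasure μ] (hf : AllMoments f μ) (k : ℕ) :
    AllMoments (fun x => f x ^ k) μ := by
  induction k with
  | zero => simpa using const (μ := μ) 1
  | succ k ih => simpa [pow_succ] using ih.mul hf

theorem abs (hf : AllMoments f μ) : AllMoments (fun x => |f x|) μ := fun p => (hf p).abs

theorem sum {ι : Type*} (s : Finset ι) {F : ι → α → ℝ} (hF : ∀ i ∈ s, AllMoments (F i) μ) :
    AllMoments (fun x => ∑ i ∈ s, F i x) μ :=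
  fun p => memLp_finsetSum s fun i hi => hF i hi p

theorem comp_measurePreserving {β : Type*} [MeasurableSpace β] {ν : Measure β} {h : β → α}
    (hf : AllMoments f μ) (hh : MeasurePreserving h ν μ) : AllMoments (fun x => f (h x)) ν :=
  fun p => (hf p).comp_measurePreserving hh

/-- The **Cauchy-Schwarz inequality**. -/
theorem sq_integral_mul_le [IsFiniteMeasure μ] (hf : AllMoments f μ) (hg : AllMoments g μ) :
    (∫ x, f x * g x ∂μ) ^ 2 ≤ (∫ x, f x ^ 2 ∂μ) * ∫ x, g x ^ 2 ∂μ := by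
  have h : ∀ t : ℝ, 0 ≤ (∫ x, f x ^ 2 ∂μ) * (t * t) + (2 * ∫ x, f x * g x ∂μ) * t +
      ∫ x, g x ^ 2 ∂μ := by
    intro t
    have h1 : ∫ x, (t * f x + g x) ^ 2 ∂μ = (∫ x, f x ^ 2 ∂μ) * (t * t) +
        (2 * ∫ x, f x * g x ∂μ) * t + ∫ x, g x ^ 2 ∂μ := by
      have e : ∀ x, (t * f x + g x) ^ 2 = (t * t) * f x ^ 2 + (2 * t) * (f x * g x) + g x ^ 2 :=
        fun x => by ring
      simp_rw [e]
      rw [integral_add (((hf.pow 2).const_mul _).add ((hf.mul hg).const_mul _)).integrable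
        (hg.pow 2).integrable, integral_add ((hf.pow 2).const_mul _).integrable
        ((hf.mul hg).const_mul _).integrable, integral_const_mul, integral_const_mul]
      ring
    rw [← h1]
    exact integral_nonneg fun x => sq_nonneg _
  have h2 := discrim_le_zero h
  rw [discrim] at h2
  nlinarith

theorem pow_integral_le [IsProbabilityMeasure μ] (hf : AllMoments f μ) {p : ℕ} (hp : Even p) :
    (∫ x, f x ∂μ) ^ p ≤ ∫ x, f x ^ p ∂μ :=
  ConvexOn.map_integral_le (g := fun z : ℝ => z ^ p) hp.convexOn_pow (by fun_prop) isClosed_univ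
    (by simp) hf.integrable (hf.pow p).integrable

/-- The square of a concentrated random variable is concentrated. -/
theorem integral_sq_sub_pow_four_le [IsProbabilityMeasure μ] (hf : AllMoments f μ) {A c₄ c₈ : ℝ}
    (hA : ∫ x, f x ^ 2 ∂μ ≤ A) (h₄ : ∫ x, (f x - ∫ y, f y ∂μ) ^ 4 ∂μ ≤ c₄)
    (h₈ : ∫ x, (f x - ∫ y, f y ∂μ) ^ 8 ∂μ ≤ c₈) :
    ∫ x, (f x ^ 2 - ∫ y, f y ^ 2 ∂μ) ^ 4 ∂μ ≤ 27 * (16 * A ^ 2 * c₄ + 2 * c₈) := by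
  set m := ∫ y, f y ∂μ with hm
  have hg : AllMoments (fun x => f x - m) μ := hf.sub (const m)
  set G := ∫ y, (f y - m) ^ 2 ∂μ with hG
  have hmean : ∫ y, f y ^ 2 ∂μ = m ^ 2 + G := by
    have e : ∀ x, f x ^ 2 = (f x - m) ^ 2 + (2 * m * f x - m ^ 2) := fun x => by ring
    simp_rw [e]
    rw [integral_add (hg.pow 2).integrable ((hf.const_mul _).sub (const _)).integrable,
      integral_sub (hf.const_mul _).integrable (const _).integrable, integral_const_mul, ← hm]
    simp
    ring
  have hmA : m ^ 2 ≤ A := (hf.pow_integral_le even_two).trans hA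
  have hA0 : 0 ≤ A := (sq_nonneg m).trans hmA
  have hm4 : m ^ 4 ≤ A ^ 2 := by nlinarith [sq_nonneg m]
  have hG4 : G ^ 4 ≤ c₈ := by
    refine ((hg.pow 2).pow_integral_le (p := 4) (by decide)).trans (le_trans (le_of_eq ?_) h₈)
    simp_rw [← pow_mul]
  have hpt : ∀ x, (f x ^ 2 - ∫ y, f y ^ 2 ∂μ) ^ 4 ≤
      27 * (16 * m ^ 4 * (f x - m) ^ 4 + ((f x - m) ^ 8 + G ^ 4)) := by
    intro x
    have h3 : ∀ a b c : ℝ, (a + b - c) ^ 4 ≤ 27 * (a ^ 4 + b ^ 4 + c ^ 4) := by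
      intro a b c
      have h1 : (a + b - c) ^ 2 ≤ 3 * (a ^ 2 + b ^ 2 + c ^ 2) := by
        nlinarith [sq_nonneg (a - b), sq_nonneg (a + c), sq_nonneg (b + c)]
      have h2 : (a ^ 2 + b ^ 2 + c ^ 2) ^ 2 ≤ 3 * (a ^ 4 + b ^ 4 + c ^ 4) := by
        nlinarith [sq_nonneg (a ^ 2 - b ^ 2), sq_nonneg (a ^ 2 - c ^ 2),
          sq_nonneg (b ^ 2 - c ^ 2)]
      calc (a + b - c) ^ 4 = ((a + b - c) ^ 2) ^ 2 := by ring
        _ ≤ (3 * (a ^ 2 + b ^ 2 + c ^ 2)) ^ 2 := pow_le_pow_left₀ (sq_nonneg _) h1 2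
        _ ≤ _ := by nlinarith
    have e : f x ^ 2 - ∫ y, f y ^ 2 ∂μ = 2 * m * (f x - m) + (f x - m) ^ 2 - G := by
      rw [hmean]; ring
    rw [e]
    refine (h3 _ _ _).trans (le_of_eq ?_)
    ring
  have hi1 : AllMoments (fun x => 16 * m ^ 4 * (f x - m) ^ 4) μ := (hg.pow 4).const_mul _
  have hi2 : AllMoments (fun x => (f x - m) ^ 8 + G ^ 4) μ := (hg.pow 8).add (const _)
  calc _ ≤ ∫ x, 27 * (16 * m ^ 4 * (f x - m) ^ 4 + ((f x - m) ^ 8 + G ^ 4)) ∂μ :=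
        integral_mono (((hf.pow 2).sub (const _)).pow 4).integrable
          ((hi1.add hi2).const_mul 27).integrable hpt
    _ = 27 * (16 * m ^ 4 * (∫ x, (f x - m) ^ 4 ∂μ) + ((∫ x, (f x - m) ^ 8 ∂μ) + G ^ 4)) := by
        rw [integral_const_mul, integral_add hi1.integrable hi2.integrable, integral_const_mul,
          integral_add (hg.pow 8).integrable (const _).integrable]
        simp
    _ ≤ _ := by
        have h0 : 0 ≤ ∫ x, (f x - m) ^ 4 ∂μ := integral_nonneg fun x => by positivity
        have h5 : m ^ 4 * (∫ x, (f x - m) ^ 4 ∂μ) ≤ A ^ 2 * c₄ := by gcongr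
        nlinarith

end AllMoments

end AllMoments

theorem add_pow_four_le (a b : ℝ) : (a + b) ^ 4 ≤ 8 * (a ^ 4 + b ^ 4) := by
  have h := Even.add_pow_le (a := a) (b := b) (by decide : Even 4)
  norm_num at h
  exact h

section GaussianMoments

variable {E : Type*} [NormedAddCommGroup E] [InnerProductSpace ℝ E] [FiniteDimensional ℝ E]
  [MeasurableSpace E] [BorelSpace E]

theorem LipschitzWith.allMoments_stdGaussian {f : E → ℝ} {L : ℝ≥0} (hf : LipschitzWith L f) :
    AllMoments f (stdGaussian E) := by
  intro p
  have h0 : MemLp (fun x : E => ‖x‖) p (stdGaussian E) :=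
    (IsGaussian.memLp_id (stdGaussian E) p ENNReal.coe_ne_top).norm
  have h1 : MemLp (fun x : E => ‖f 0‖ + L * ‖x‖) p (stdGaussian E) :=
    (memLp_const ‖f 0‖).add (h0.const_mul (L : ℝ))
  refine h1.mono' hf.continuous.aestronglyMeasurable (Eventually.of_forall fun x => ?_)
  have h2 := hf.dist_le_mul x 0
  rw [dist_eq_norm, dist_zero_right] at h2
  calc ‖f x‖ = ‖f 0 + (f x - f 0)‖ := by congr 1; ring
    _ ≤ _ := (norm_add_le _ _).trans (by gcongr)

/-- Concentration of Lipschitz functions of a standard Gaussian vector, in terms of moments. The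
constant does not depend on the dimension. -/
theorem integral_sub_mean_pow_le {f : E → ℝ} {L : ℝ≥0} (hf : LipschitzWith L f) {p : ℕ}
    (hp : Even p) :
    ∫ x, (f x - ∫ y, f y ∂(stdGaussian E)) ^ p ∂(stdGaussian E) ≤ concConst p * L ^ p := by
  set ν := stdGaussian E
  have hm : AllMoments f ν := hf.allMoments_stdGaussian
  have h1 : AllMoments (fun z : E × E => f z.2 - f z.1) (ν.prod ν) :=
    (hm.comp_measurePreserving measurePreserving_snd).sub
      (hm.comp_measurePreserving measurePreserving_fst)
  have h2 : ∫ z, (f z.2 - f z.1) ^ p ∂(ν.prod ν) ≤ concConst p * L ^ p := by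
    rw [integral_eq_lintegral_of_nonneg_ae (Eventually.of_forall fun z => hp.pow_nonneg _)
      (h1.pow p).integrable.aestronglyMeasurable]
    have h0 : 0 ≤ concConst p * (L : ℝ) ^ p :=
      mul_nonneg (concConst_nonneg p) (pow_nonneg L.coe_nonneg p)
    exact ENNReal.toReal_le_of_le_ofReal h0 (lintegral_pow_sub_le hf hp)
  rw [integral_prod_symm _ (h1.pow p).integrable] at h2
  refine (integral_mono ?_ ?_ fun y => ?_).trans h2
  · exact ((hm.sub (AllMoments.const (∫ y, f y ∂ν))).pow p).integrable
  · exact (h1.pow p).integrable.integral_prod_right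
  · have h3 : f y - ∫ x, f x ∂ν = ∫ x, (f y - f x) ∂ν := by
      rw [integral_sub (integrable_const _) hm.integrable]
      simp
    simp only [h3]
    exact ((AllMoments.const (f y)).sub hm).pow_integral_le hp

variable {n : ℕ}

theorem map_toLp_pi_stdGaussian :
    (Measure.pi fun _ : Fin n => stdGaussian E).map (WithLp.toLp 2) =
      stdGaussian (PiLp 2 fun _ : Fin n => E) := by
  apply Measure.ext_of_charFun
  ext t
  simp_rw [charFun_stdGaussian, charFun_pi, charFun_stdGaussian, ← Complex.exp_sum,
    ← Complex.ofReal_pow, PiLp.norm_sq_eq_of_L2]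
  simp [Finset.sum_div, neg_div]

theorem measurePreserving_toLp_pi_stdGaussian :
    MeasurePreserving (WithLp.toLp 2 : (Fin n → E) → PiLp 2 fun _ : Fin n => E)
      (Measure.pi fun _ : Fin n => stdGaussian E) (stdGaussian (PiLp 2 fun _ : Fin n => E)) :=
  ⟨by fun_prop, map_toLp_pi_stdGaussian⟩

/-- Concentration of Lipschitz functions of finitely many independent Gaussian vectors. -/
theorem integral_pi_sub_mean_pow_le {f : (Fin n → E) → ℝ} {L : ℝ≥0}
    (hf : LipschitzWith L fun w : PiLp 2 (fun _ : Fin n => E) => f w.ofLp) {p : ℕ} (hp : Even p) :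
    ∫ x, (f x - ∫ y, f y ∂(Measure.pi fun _ : Fin n => stdGaussian E)) ^ p
      ∂(Measure.pi fun _ : Fin n => stdGaussian E) ≤ concConst p * L ^ p := by
  have h := integral_sub_mean_pow_le hf hp
  have hmp := measurePreserving_toLp_pi_stdGaussian (E := E) (n := n)
  have hemb : MeasurableEmbedding (WithLp.toLp 2 : (Fin n → E) → PiLp 2 fun _ : Fin n => E) :=
    (MeasurableEquiv.toLp 2 (Fin n → E)).measurableEmbedding
  rw [← hmp.integral_comp hemb, ← hmp.integral_comp hemb] at h
  exact h

end GaussianMoments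

/-! ### Euclidean norms and bilinear forms of real matrices -/

section Euclidean

variable {ι κ : Type*} [Fintype ι] [Fintype κ]

/-- The Euclidean norm of a plain vector `ι → ℝ`, whose own norm is the sup norm. -/
noncomputable def l2 (u : ι → ℝ) : ℝ := ‖WithLp.toLp 2 u‖

theorem l2_nonneg (u : ι → ℝ) : 0 ≤ l2 u := norm_nonneg _

theorem l2_sq (u : ι → ℝ) : l2 u ^ 2 = u ⬝ᵥ u := by
  rw [l2, EuclideanSpace.real_norm_sq_eq]
  simp [dotProduct, sq]

theorem abs_dotProduct_le (u v : ι → ℝ) : |u ⬝ᵥ v| ≤ l2 u * l2 v := by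
  have h := abs_real_inner_le_norm (WithLp.toLp 2 v : EuclideanSpace ℝ ι) (WithLp.toLp 2 u)
  rw [EuclideanSpace.inner_toLp_toLp] at h
  rw [mul_comm]
  simpa [l2] using h

theorem l2_smul (c : ℝ) (u : ι → ℝ) : l2 (c • u) = |c| * l2 u := by
  simp [l2, WithLp.toLp_smul, norm_smul]

theorem l2_mulVec_le [DecidableEq κ] (M : Matrix ι κ ℝ) (u : κ → ℝ) :
    l2 (M *ᵥ u) ≤ ‖M‖ * l2 u :=
  Matrix.l2_opNorm_mulVec M (WithLp.toLp 2 u)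

theorem abs_dotProduct_mulVec_le [DecidableEq κ] (M : Matrix ι κ ℝ) (u : ι → ℝ) (v : κ → ℝ) :
    |u ⬝ᵥ M *ᵥ v| ≤ ‖M‖ * l2 u * l2 v := by
  calc |u ⬝ᵥ M *ᵥ v| ≤ l2 u * l2 (M *ᵥ v) := abs_dotProduct_le _ _
    _ ≤ l2 u * (‖M‖ * l2 v) := by
        gcongr
        · exact l2_nonneg u
        · exact l2_mulVec_le M v
    _ = _ := by ring

theorem norm_le_of_l2_mulVec_le [DecidableEq κ] {M : Matrix ι κ ℝ} {C : ℝ} (hC : 0 ≤ C)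
    (h : ∀ v, l2 (M *ᵥ v) ≤ C * l2 v) : ‖M‖ ≤ C := by
  rw [Matrix.l2_opNorm_def]
  exact ContinuousLinearMap.opNorm_le_bound _ hC fun v => h v.ofLp

theorem norm_le_of_bilin [DecidableEq κ] {M : Matrix ι κ ℝ} {C : ℝ} (hC : 0 ≤ C)
    (h : ∀ u v, |u ⬝ᵥ M *ᵥ v| ≤ C * l2 u * l2 v) : ‖M‖ ≤ C := by
  refine norm_le_of_l2_mulVec_le hC fun v => ?_
  have h1 := (le_abs_self _).trans (h (M *ᵥ v) v)
  rw [← l2_sq] at h1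
  rcases (l2_nonneg (M *ᵥ v)).eq_or_lt with h0 | h0
  · rw [← h0]
    exact mul_nonneg hC (l2_nonneg v)
  · nlinarith

theorem norm_le_of_unit_bilin [DecidableEq κ] {M : Matrix ι κ ℝ} {C : ℝ} (hC : 0 ≤ C)
    (h : ∀ u v, l2 u = 1 → l2 v = 1 → |u ⬝ᵥ M *ᵥ v| ≤ C) : ‖M‖ ≤ C := by
  refine norm_le_of_bilin hC fun u v => ?_
  rcases (l2_nonneg u).eq_or_lt with hu | hu
  · have := abs_dotProduct_mulVec_le M u v
    rw [← hu] at this ⊢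
    simpa using this
  rcases (l2_nonneg v).eq_or_lt with hv | hv
  · have := abs_dotProduct_mulVec_le M u v
    rw [← hv] at this ⊢
    simpa using this
  have h1 := h ((l2 u)⁻¹ • u) ((l2 v)⁻¹ • v)
    (by rw [l2_smul, abs_of_pos (inv_pos.2 hu), inv_mul_cancel₀ hu.ne'])
    (by rw [l2_smul, abs_of_pos (inv_pos.2 hv), inv_mul_cancel₀ hv.ne'])
  rw [Matrix.mulVec_smul, smul_dotProduct, dotProduct_smul, smul_eq_mul, smul_eq_mul, abs_mul,
    abs_mul, abs_of_pos (inv_pos.2 hu), abs_of_pos (inv_pos.2 hv)] at h1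
  have h2 : |u ⬝ᵥ M *ᵥ v| = (l2 u)⁻¹ * ((l2 v)⁻¹ * |u ⬝ᵥ M *ᵥ v|) * (l2 u * l2 v) := by
    field_simp
  rw [h2, mul_assoc C]
  gcongr

theorem mulVec_dotProduct_comm {M : Matrix ι ι ℝ} (hM : Mᵀ = M) (u v : ι → ℝ) :
    (M *ᵥ u) ⬝ᵥ v = u ⬝ᵥ M *ᵥ v := by
  rw [Matrix.dotProduct_mulVec, ← Matrix.mulVec_transpose, hM]

end Euclidean

/-! ### Resolvents of positive semidefinite matrices -/

section Reg

variable {ι : Type*} [Fintype ι]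

theorem dotProduct_mulVec_self_nonneg {G : Matrix ι ι ℝ} (hG : G.PosSemidef) (u : ι → ℝ) :
    0 ≤ u ⬝ᵥ G *ᵥ u := by
  simpa using hG.dotProduct_mulVec_nonneg u

variable [DecidableEq ι]

/-- The resolvent `(G + γ I)⁻¹`, for `G` positive semidefinite and `γ > 0`. -/
noncomputable def reg (γ : ℝ) (G : Matrix ι ι ℝ) : Matrix ι ι ℝ :=
  (G + γ • (1 : Matrix ι ι ℝ))⁻¹

variable {γ : ℝ} {G H : Matrix ι ι ℝ}

theorem isUnit_det_add_smul_one (hγ : 0 < γ) (hG : G.PosSemidef) :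
    IsUnit (G + γ • (1 : Matrix ι ι ℝ)).det :=
  (Matrix.isUnit_iff_isUnit_det _).1
    (Matrix.PosDef.posSemidef_add hG (Matrix.PosDef.one.smul hγ)).isUnit

theorem mul_reg (hγ : 0 < γ) (hG : G.PosSemidef) :
    (G + γ • (1 : Matrix ι ι ℝ)) * reg γ G = 1 :=
  Matrix.mul_nonsing_inv _ (isUnit_det_add_smul_one hγ hG)

theorem reg_mul (hγ : 0 < γ) (hG : G.PosSemidef) :
    reg γ G * (G + γ • (1 : Matrix ι ι ℝ)) = 1 :=
  Matrix.nonsing_inv_mul _ (isUnit_det_add_smul_one hγ hG)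

theorem transpose_reg (hG : G.PosSemidef) : (reg γ G)ᵀ = reg γ G := by
  have h : Gᵀ = G := by simpa using hG.isHermitian.eq
  rw [reg, Matrix.transpose_nonsing_inv, Matrix.transpose_add, Matrix.transpose_smul,
    Matrix.transpose_one, h]

/-- The resolvent identity. -/
theorem reg_sub_reg (hγ : 0 < γ) (hG : G.PosSemidef) (hH : H.PosSemidef) :
    reg γ G - reg γ H = reg γ G * (H - G) * reg γ H := by
  have h : H - G = (H + γ • (1 : Matrix ι ι ℝ)) - (G + γ • (1 : Matrix ι ι ℝ)) := by abel
  rw [h, mul_sub, sub_mul, mul_assoc, mul_reg hγ hH, reg_mul hγ hG, mul_one, one_mul]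

theorem mulVec_reg_add (hγ : 0 < γ) (hG : G.PosSemidef) (u : ι → ℝ) :
    G *ᵥ reg γ G *ᵥ u + γ • (reg γ G *ᵥ u) = u := by
  have h := congrArg (· *ᵥ u) (mul_reg hγ hG)
  simpa [add_mul, Matrix.add_mulVec, Matrix.smul_mulVec, ← Matrix.mulVec_mulVec] using h

/-- With `v = (G + γ I)⁻¹ u`, this is `uᵀ v = vᵀ G v + γ ‖v‖²`. -/
theorem dotProduct_reg_self (hγ : 0 < γ) (hG : G.PosSemidef) (u : ι → ℝ) :
    u ⬝ᵥ reg γ G *ᵥ u = (reg γ G *ᵥ u) ⬝ᵥ G *ᵥ reg γ G *ᵥ u + γ * l2 (reg γ G *ᵥ u) ^ 2 := by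
  conv_lhs => rw [dotProduct_comm]; arg 2; rw [← mulVec_reg_add hγ hG u]
  rw [dotProduct_add, dotProduct_smul, l2_sq, smul_eq_mul]

theorem l2_reg_le (hγ : 0 < γ) (hG : G.PosSemidef) (u : ι → ℝ) :
    l2 (reg γ G *ᵥ u) ≤ 1 / γ * l2 u := by
  have h1 := dotProduct_reg_self hγ hG u
  have h2 := dotProduct_mulVec_self_nonneg hG (reg γ G *ᵥ u)
  have h3 := (le_abs_self _).trans (abs_dotProduct_le u (reg γ G *ᵥ u))
  rw [div_mul_eq_mul_div, one_mul, le_div_iff₀ hγ]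
  rcases (l2_nonneg (reg γ G *ᵥ u)).eq_or_lt with h0 | h0
  · rw [← h0, zero_mul]
    exact l2_nonneg u
  · nlinarith

theorem norm_reg_le (hγ : 0 < γ) (hG : G.PosSemidef) : ‖reg γ G‖ ≤ 1 / γ :=
  norm_le_of_l2_mulVec_le (by positivity) (l2_reg_le hγ hG)

theorem dotProduct_reg_nonneg (hγ : 0 < γ) (hG : G.PosSemidef) (u : ι → ℝ) :
    0 ≤ u ⬝ᵥ reg γ G *ᵥ u := by
  rw [dotProduct_reg_self hγ hG]
  have := dotProduct_mulVec_self_nonneg hG (reg γ G *ᵥ u)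
  positivity

theorem dotProduct_reg_le (hγ : 0 < γ) (hG : G.PosSemidef) (u : ι → ℝ) :
    u ⬝ᵥ reg γ G *ᵥ u ≤ 1 / γ * l2 u ^ 2 := by
  refine (le_abs_self _).trans ((abs_dotProduct_mulVec_le _ u u).trans ?_)
  rw [sq, ← mul_assoc]
  have := l2_nonneg u
  gcongr
  exact norm_reg_le hγ hG

theorem quadratic_reg_le (hγ : 0 < γ) (hG : G.PosSemidef) (u : ι → ℝ) :
    (reg γ G *ᵥ u) ⬝ᵥ G *ᵥ reg γ G *ᵥ u ≤ 1 / γ * l2 u ^ 2 := by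
  have h1 := dotProduct_reg_le hγ hG u
  rw [dotProduct_reg_self hγ hG] at h1
  have : 0 ≤ γ * l2 (reg γ G *ᵥ u) ^ 2 := by positivity
  linarith

theorem posSemidef_reg (hγ : 0 < γ) (hG : G.PosSemidef) : (reg γ G).PosSemidef :=
  (Matrix.PosDef.posSemidef_add hG (Matrix.PosDef.one.smul hγ)).inv.posSemidef

/-- The contraction `G (G + γ I)⁻¹`. -/
theorem norm_mul_reg_le (hγ : 0 < γ) (hG : G.PosSemidef) : ‖G * reg γ G‖ ≤ 1 := by
  refine norm_le_of_l2_mulVec_le zero_le_one fun u => ?_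
  rw [one_mul, ← Matrix.mulVec_mulVec]
  set v := reg γ G *ᵥ u with hv
  have h1 : l2 u ^ 2 = l2 (G *ᵥ v) ^ 2 + 2 * γ * (v ⬝ᵥ G *ᵥ v) + γ ^ 2 * l2 v ^ 2 := by
    have h2 := mulVec_reg_add hγ hG u
    rw [← hv] at h2
    rw [l2_sq, l2_sq, l2_sq]
    conv_lhs => rw [← h2]
    simp only [dotProduct_add, add_dotProduct, dotProduct_smul, smul_dotProduct, smul_eq_mul,
      dotProduct_comm (G *ᵥ v) v]
    ring
  have h2 := dotProduct_mulVec_self_nonneg hG v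
  refine abs_le_of_sq_le_sq' ?_ (l2_nonneg u) |>.2
  have : 0 ≤ 2 * γ * (v ⬝ᵥ G *ᵥ v) + γ ^ 2 * l2 v ^ 2 := by positivity
  linarith

end Reg

/-! ### Resolvents of Gram matrices -/

section Gram

variable {n T : ℕ} {γ : ℝ}

/-- The normalised Gram matrix `(1/T) Sᵀ S`. -/
noncomputable def gram (S : Matrix (Fin n) (Fin T) ℝ) : Matrix (Fin T) (Fin T) ℝ :=
  (1 / (T : ℝ)) • (Sᵀ * S)

theorem posSemidef_gram (S : Matrix (Fin n) (Fin T) ℝ) : (gram S).PosSemidef := by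
  have h := Matrix.posSemidef_conjTranspose_mul_self S
  rw [Matrix.conjTranspose_eq_transpose_of_trivial] at h
  exact h.smul (by positivity)

theorem dotProduct_gram (S : Matrix (Fin n) (Fin T) ℝ) (u v : Fin T → ℝ) :
    u ⬝ᵥ gram S *ᵥ v = 1 / (T : ℝ) * ((S *ᵥ u) ⬝ᵥ (S *ᵥ v)) := by
  rw [gram, Matrix.smul_mulVec, dotProduct_smul, smul_eq_mul, ← Matrix.mulVec_mulVec,
    Matrix.dotProduct_mulVec, Matrix.vecMul_transpose]

theorem l2_mulVec_reg_gram_sq_le (hγ : 0 < γ) (S : Matrix (Fin n) (Fin T) ℝ) (u : Fin T → ℝ) :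
    1 / (T : ℝ) * l2 (S *ᵥ reg γ (gram S) *ᵥ u) ^ 2 ≤ 1 / γ * l2 u ^ 2 := by
  have h := quadratic_reg_le hγ (posSemidef_gram S) u
  rwa [dotProduct_gram, ← l2_sq] at h

/-- The Frobenius norm of a matrix. -/
noncomputable def frob (D : Matrix (Fin n) (Fin T) ℝ) : ℝ := √(∑ i, l2 (D i) ^ 2)

theorem frob_nonneg (D : Matrix (Fin n) (Fin T) ℝ) : 0 ≤ frob D := Real.sqrt_nonneg _

theorem frob_sq (D : Matrix (Fin n) (Fin T) ℝ) : frob D ^ 2 = ∑ i, l2 (D i) ^ 2 :=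
  Real.sq_sqrt (Finset.sum_nonneg fun _ _ => sq_nonneg _)

theorem l2_mulVec_le_frob (D : Matrix (Fin n) (Fin T) ℝ) (u : Fin T → ℝ) :
    l2 (D *ᵥ u) ≤ frob D * l2 u := by
  refine abs_le_of_sq_le_sq' ?_ (mul_nonneg (frob_nonneg D) (l2_nonneg u)) |>.2
  rw [mul_pow, frob_sq, Finset.sum_mul, l2_sq]
  refine Finset.sum_le_sum fun i _ => ?_
  rw [← sq, ← mul_pow, ← sq_abs]
  exact pow_le_pow_left₀ (abs_nonneg _) (abs_dotProduct_le _ _) 2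

/-- The resolvent of the Gram matrix is a Lipschitz function of `S`. -/
theorem norm_reg_gram_sub_le (hγ : 0 < γ) (hT : 0 < T) (S S' : Matrix (Fin n) (Fin T) ℝ) :
    ‖reg γ (gram S) - reg γ (gram S')‖ ≤ 2 / (γ * √γ * √T) * frob (S' - S) := by
  set R := reg γ (gram S) with hR
  set R' := reg γ (gram S') with hR'
  have hT' : (0 : ℝ) < T := by exact_mod_cast hT
  have hF : 0 ≤ frob (S' - S) := frob_nonneg _
  have hSR : ∀ (A : Matrix (Fin n) (Fin T) ℝ) (u : Fin T → ℝ),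
      l2 (A *ᵥ reg γ (gram A) *ᵥ u) ≤ √T / √γ * l2 u := by
    intro A u
    have hu := l2_nonneg u
    refine abs_le_of_sq_le_sq' ?_ (by positivity) |>.2
    rw [mul_pow, div_pow, Real.sq_sqrt hT'.le, Real.sq_sqrt hγ.le]
    have h := l2_mulVec_reg_gram_sq_le hγ A u
    rw [div_mul_eq_mul_div, one_mul, div_le_iff₀ hT'] at h
    calc _ ≤ _ := h
      _ = _ := by ring
  refine norm_le_of_bilin (by positivity) fun u v => ?_
  -- `S'ᵀ S' - Sᵀ S = Sᵀ D + Dᵀ S'`, which pairs each of `S`, `S'` with its own resolvent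
  have h1 : u ⬝ᵥ (R - R') *ᵥ v = 1 / (T : ℝ) * ((S *ᵥ R *ᵥ u) ⬝ᵥ ((S' - S) *ᵥ R' *ᵥ v) +
      ((S' - S) *ᵥ R *ᵥ u) ⬝ᵥ (S' *ᵥ R' *ᵥ v)) := by
    rw [hR, hR', reg_sub_reg hγ (posSemidef_gram S) (posSemidef_gram S'), ← hR, ← hR',
      ← Matrix.mulVec_mulVec, ← Matrix.mulVec_mulVec,
      ← mulVec_dotProduct_comm (transpose_reg (posSemidef_gram S)), Matrix.sub_mulVec,
      dotProduct_sub, dotProduct_gram, dotProduct_gram, ← hR, Matrix.sub_mulVec, Matrix.sub_mulVec,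
      dotProduct_sub, sub_dotProduct]
    ring
  have hu := l2_nonneg u
  have hv := l2_nonneg v
  have hb1 : |(S *ᵥ R *ᵥ u) ⬝ᵥ ((S' - S) *ᵥ R' *ᵥ v)| ≤
      (√T / √γ * l2 u) * (frob (S' - S) * (1 / γ * l2 v)) := by
    refine (abs_dotProduct_le _ _).trans (mul_le_mul (hSR S u) ?_ (l2_nonneg _) (by positivity))
    exact (l2_mulVec_le_frob _ _).trans
      (mul_le_mul_of_nonneg_left (l2_reg_le hγ (posSemidef_gram S') v) hF)
  have hb2 : |((S' - S) *ᵥ R *ᵥ u) ⬝ᵥ (S' *ᵥ R' *ᵥ v)| ≤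
      (frob (S' - S) * (1 / γ * l2 u)) * (√T / √γ * l2 v) := by
    refine (abs_dotProduct_le _ _).trans (mul_le_mul ?_ (hSR S' v) (l2_nonneg _) (by positivity))
    exact (l2_mulVec_le_frob _ _).trans
      (mul_le_mul_of_nonneg_left (l2_reg_le hγ (posSemidef_gram S) u) hF)
  rw [h1, abs_mul, abs_of_nonneg (by positivity)]
  calc _ ≤ 1 / (T : ℝ) * ((√T / √γ * l2 u) * (frob (S' - S) * (1 / γ * l2 v)) +
        (frob (S' - S) * (1 / γ * l2 u)) * (√T / √γ * l2 v)) := by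
        gcongr
        exact (abs_add_le _ _).trans (add_le_add hb1 hb2)
    _ = 1 / (√T * √T) * ((√T / √γ * l2 u) * (frob (S' - S) * (1 / γ * l2 v)) +
        (frob (S' - S) * (1 / γ * l2 u)) * (√T / √γ * l2 v)) := by
        rw [Real.mul_self_sqrt hT'.le]
    _ = _ := by
        have h2 : 0 < √(T : ℝ) := Real.sqrt_pos.2 hT'
        have h3 : 0 < √γ := Real.sqrt_pos.2 hγ
        field_simp
        ring

/-- Replacing the `i`-th row by zero removes one rank-one term of the Gram matrix. -/
theorem gram_sub_gram_updateRow (S : Matrix (Fin n) (Fin T) ℝ) (i : Fin n) :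
    gram S - gram (S.updateRow i 0) = (1 / (T : ℝ)) • Matrix.vecMulVec (S i) (S i) := by
  rw [gram, gram, ← smul_sub]
  congr 1
  ext a b
  simp only [Matrix.sub_apply, Matrix.mul_apply, Matrix.transpose_apply, Matrix.vecMulVec_apply,
    ← Finset.sum_sub_distrib]
  rw [Finset.sum_eq_single i]
  · simp
  · intro j _ hj
    simp [Matrix.updateRow_ne hj]
  · simp

/-- The quadratic form `(1/T) sᵀ Q₋ s` of the `i`-th row `s`, with `Q₋` the resolvent of the
remaining rows. -/
noncomputable def rowForm (γ : ℝ) (S : Matrix (Fin n) (Fin T) ℝ) (i : Fin n) : ℝ :=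
  1 / (T : ℝ) * (S i ⬝ᵥ reg γ (gram (S.updateRow i 0)) *ᵥ S i)

theorem rowForm_nonneg (hγ : 0 < γ) (S : Matrix (Fin n) (Fin T) ℝ) (i : Fin n) :
    0 ≤ rowForm γ S i :=
  mul_nonneg (by positivity) (dotProduct_reg_nonneg hγ (posSemidef_gram _) _)

theorem dotProduct_rankOne (u a b v : Fin T → ℝ) :
    u ⬝ᵥ Matrix.vecMulVec a b *ᵥ v = (u ⬝ᵥ a) * (b ⬝ᵥ v) := by
  rw [Matrix.vecMulVec_mulVec, dotProduct_smul]
  simp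

/-- The Sherman-Morrison relation `Q₋ s = (1 + d) Q s` between the resolvents `Q` and `Q₋` with and
without the row `s`, where `d = (1/T) sᵀ Q₋ s`. -/
theorem reg_updateRow_mulVec_row (hγ : 0 < γ) (S : Matrix (Fin n) (Fin T) ℝ) (i : Fin n)
    (u : Fin T → ℝ) :
    u ⬝ᵥ reg γ (gram (S.updateRow i 0)) *ᵥ S i =
      (1 + rowForm γ S i) * (u ⬝ᵥ reg γ (gram S) *ᵥ S i) := by
  have h := reg_sub_reg hγ (posSemidef_gram S) (posSemidef_gram (S.updateRow i 0))
  rw [← neg_sub (gram S), gram_sub_gram_updateRow] at h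
  have h1 := congrArg (fun M => u ⬝ᵥ M *ᵥ S i) h
  simp only [Matrix.sub_mulVec, dotProduct_sub, ← Matrix.mulVec_mulVec, Matrix.neg_mulVec,
    Matrix.smul_mulVec, Matrix.mulVec_neg, Matrix.mulVec_smul, dotProduct_neg, dotProduct_smul,
    smul_eq_mul] at h1
  rw [← mulVec_dotProduct_comm (transpose_reg (posSemidef_gram S)) u
    (Matrix.vecMulVec _ _ *ᵥ _), dotProduct_rankOne, mulVec_dotProduct_comm (transpose_reg (posSemidef_gram S))] at h1
  rw [rowForm]
  linarith

/-- The rank-one formula `Q₋ - Q = ((1 + d) / T) (Q s) (Q s)ᵀ`, as an identity of bilinear forms. -/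
theorem dotProduct_reg_updateRow_sub (hγ : 0 < γ) (S : Matrix (Fin n) (Fin T) ℝ) (i : Fin n)
    (u v : Fin T → ℝ) :
    u ⬝ᵥ (reg γ (gram (S.updateRow i 0)) - reg γ (gram S)) *ᵥ v = (1 + rowForm γ S i) *
      (1 / (T : ℝ)) * (u ⬝ᵥ reg γ (gram S) *ᵥ S i) * (v ⬝ᵥ reg γ (gram S) *ᵥ S i) := by
  rw [reg_sub_reg hγ (posSemidef_gram (S.updateRow i 0)) (posSemidef_gram S),
    gram_sub_gram_updateRow, ← Matrix.mulVec_mulVec, ← Matrix.mulVec_mulVec,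
    ← mulVec_dotProduct_comm (transpose_reg (posSemidef_gram _)), Matrix.smul_mulVec,
    dotProduct_smul, dotProduct_rankOne, mulVec_dotProduct_comm (transpose_reg (posSemidef_gram _)),
    reg_updateRow_mulVec_row hγ, ← mulVec_dotProduct_comm (transpose_reg (posSemidef_gram S)),
    ← mulVec_dotProduct_comm (transpose_reg (posSemidef_gram S)) v, dotProduct_comm (S i),
    smul_eq_mul]
  ring

/-- The sum over the rows is `uᵀ Q (Sᵀ S) Q u`, and `Q ((1/T) Sᵀ S) Q ≤ Q ≤ 1/γ`. -/
theorem sum_sq_row_le (hγ : 0 < γ) (S : Matrix (Fin n) (Fin T) ℝ) (u : Fin T → ℝ) :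
    1 / (T : ℝ) * ∑ j, (u ⬝ᵥ reg γ (gram S) *ᵥ S j) ^ 2 ≤ 1 / γ * l2 u ^ 2 := by
  refine le_trans (le_of_eq ?_) (l2_mulVec_reg_gram_sq_le hγ S u)
  rw [l2_sq, dotProduct]
  congr 1
  refine Finset.sum_congr rfl fun j _ => ?_
  rw [← sq]
  congr 1
  rw [← mulVec_dotProduct_comm (transpose_reg (posSemidef_gram _)), dotProduct_comm]
  rfl

end Gram

/-! ### The fixed-point equation -/

section Trace

variable {ι : Type*} [Fintype ι] [DecidableEq ι] {F M : Matrix ι ι ℝ}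

open scoped MatrixOrder in
/-- A positive semidefinite matrix `F = Bᵀ B` acts on matrices, through the trace, as a sum of
quadratic forms at the rows of `B`. -/
theorem exists_trace_mul_eq_sum (hF : F.PosSemidef) : ∃ B : Matrix ι ι ℝ, F = Bᵀ * B ∧
    ∀ M : Matrix ι ι ℝ, (F * M).trace = ∑ k, B k ⬝ᵥ M *ᵥ B k := by
  obtain ⟨B, hB⟩ : ∃ B : Matrix ι ι ℝ, F = Bᵀ * B := by
    have h1 : (CFC.sqrt F)ᵀ = CFC.sqrt F := by
      rw [← Matrix.conjTranspose_eq_transpose_of_trivial]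
      exact (Matrix.nonneg_iff_posSemidef.1 (CFC.sqrt_nonneg F)).isHermitian.eq
    exact ⟨CFC.sqrt F, by rw [h1, CFC.sqrt_mul_sqrt_self F hF.nonneg]⟩
  refine ⟨B, hB, fun M => ?_⟩
  rw [hB, mul_assoc, Matrix.trace_mul_comm, Matrix.trace]
  refine Finset.sum_congr rfl fun k _ => ?_
  simp only [Matrix.diag_apply, mul_assoc, Matrix.mul_apply', Matrix.transpose_apply]
  rfl

theorem trace_mul_nonneg (hF : F.PosSemidef) (hM : M.PosSemidef) : 0 ≤ (F * M).trace := by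
  obtain ⟨B, -, hB⟩ := exists_trace_mul_eq_sum hF
  rw [hB]
  exact Finset.sum_nonneg fun k _ => dotProduct_mulVec_self_nonneg hM _

theorem abs_trace_mul_le (hF : F.PosSemidef) (M : Matrix ι ι ℝ) :
    |(F * M).trace| ≤ F.trace * ‖M‖ := by
  obtain ⟨B, -, hB⟩ := exists_trace_mul_eq_sum hF
  have h1 := hB 1
  rw [mul_one] at h1
  rw [hB, h1, Finset.sum_mul]
  refine (Finset.abs_sum_le_sum_abs _ _).trans (Finset.sum_le_sum fun k _ => ?_)
  refine (abs_dotProduct_mulVec_le M _ _).trans (le_of_eq ?_)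
  rw [Matrix.one_mulVec, ← l2_sq]
  ring

end Trace

section FixedPoint

variable {n T : ℕ} {γ : ℝ} {F : Matrix (Fin T) (Fin T) ℝ}

theorem Qbar_eq_reg (n : ℕ) (γ : ℝ) (F : Matrix (Fin T) (Fin T) ℝ) (δ : ℝ) :
    RandomFeatures.Qbar n γ F δ = reg γ (((n : ℝ) / (T : ℝ) / (1 + δ)) • F) := rfl

theorem posSemidef_smul_of_nonneg (n : ℕ) (hF : F.PosSemidef) {x : ℝ} (hx : 0 ≤ x) :
    (((n : ℝ) / (T : ℝ) / (1 + x)) • F).PosSemidef :=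
  hF.smul (by positivity)

theorem norm_Qbar_le (hγ : 0 < γ) (hF : F.PosSemidef) {x : ℝ} (hx : 0 ≤ x) :
    ‖RandomFeatures.Qbar n γ F x‖ ≤ 1 / γ :=
  norm_reg_le hγ (posSemidef_smul_of_nonneg n hF hx)

theorem posSemidef_Qbar (hγ : 0 < γ) (hF : F.PosSemidef) {x : ℝ} (hx : 0 ≤ x) :
    (RandomFeatures.Qbar n γ F x).PosSemidef :=
  posSemidef_reg hγ (posSemidef_smul_of_nonneg n hF hx)

theorem transpose_Qbar (hF : F.PosSemidef) {x : ℝ} (hx : 0 ≤ x) :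
    (RandomFeatures.Qbar n γ F x)ᵀ = RandomFeatures.Qbar n γ F x :=
  transpose_reg (posSemidef_smul_of_nonneg n hF hx)

theorem smul_mul_Qbar (hγ : 0 < γ) (hF : F.PosSemidef) {x : ℝ} (hx : 0 ≤ x) :
    ((n : ℝ) / (T : ℝ) / (1 + x)) • (F * RandomFeatures.Qbar n γ F x) =
      1 - γ • RandomFeatures.Qbar n γ F x := by
  have h := mul_reg hγ (posSemidef_smul_of_nonneg n hF hx)
  rw [← Qbar_eq_reg, add_mul, Matrix.smul_mul, Matrix.smul_mul, one_mul] at h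
  exact eq_sub_of_add_eq h

theorem smul_Qbar_mul (hγ : 0 < γ) (hF : F.PosSemidef) {x : ℝ} (hx : 0 ≤ x) :
    ((n : ℝ) / (T : ℝ) / (1 + x)) • (RandomFeatures.Qbar n γ F x * F) =
      1 - γ • RandomFeatures.Qbar n γ F x := by
  have h := reg_mul hγ (posSemidef_smul_of_nonneg n hF hx)
  rw [← Qbar_eq_reg, mul_add, Matrix.mul_smul, Matrix.mul_smul, mul_one] at h
  exact eq_sub_of_add_eq h

theorem norm_smul_mul_Qbar_le (hγ : 0 < γ) (hF : F.PosSemidef) {x : ℝ} (hx : 0 ≤ x) :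
    ‖((n : ℝ) / (T : ℝ) / (1 + x)) • (F * RandomFeatures.Qbar n γ F x)‖ ≤ 1 := by
  rw [← Matrix.smul_mul]
  exact norm_mul_reg_le hγ (posSemidef_smul_of_nonneg n hF hx)

/-- `F` commutes with its resolvent, so the product of the two is positive semidefinite. -/
theorem posSemidef_mul_Qbar (hγ : 0 < γ) (hF : F.PosSemidef) {x : ℝ} (hx : 0 ≤ x) :
    (F * RandomFeatures.Qbar n γ F x).PosSemidef := by
  set c := (n : ℝ) / (T : ℝ) / (1 + x) with hc
  have hc0 : 0 ≤ c := by positivity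
  set Q := RandomFeatures.Qbar n γ F x with hQ
  have h1 : Q * (c • F + γ • (1 : Matrix (Fin T) (Fin T) ℝ)) = 1 :=
    reg_mul hγ (posSemidef_smul_of_nonneg n hF hx)
  have hQs : Qᴴ = Q := by
    rw [Matrix.conjTranspose_eq_transpose_of_trivial]
    exact transpose_Qbar hF hx
  have h2 : F * Q = c • (Qᴴ * (Fᴴ * F) * Q) + γ • (Qᴴ * F * Q) := by
    calc F * Q = (Q * (c • F + γ • (1 : Matrix (Fin T) (Fin T) ℝ))) * (F * Q) := by
          rw [h1, one_mul]
      _ = _ := by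
          rw [hQs, hF.isHermitian.eq]
          simp only [mul_add, add_mul, Matrix.mul_smul, Matrix.smul_mul, mul_one, mul_assoc]
  rw [h2]
  exact (((Matrix.posSemidef_conjTranspose_mul_self F).conjTranspose_mul_mul_same Q).smul hc0).add
    ((hF.conjTranspose_mul_mul_same Q).smul hγ.le)

theorem Qbar_sub_Qbar (hγ : 0 < γ) (hF : F.PosSemidef) {x y : ℝ} (hx : 0 ≤ x) (hy : 0 ≤ y) :
    RandomFeatures.Qbar n γ F x - RandomFeatures.Qbar n γ F y =
      ((x - y) / (1 + y)) • ((((n : ℝ) / (T : ℝ) / (1 + x)) •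
        (RandomFeatures.Qbar n γ F x * F)) * RandomFeatures.Qbar n γ F y) := by
  have h := reg_sub_reg hγ (posSemidef_smul_of_nonneg n hF hx) (posSemidef_smul_of_nonneg n hF hy)
  rw [← Qbar_eq_reg, ← Qbar_eq_reg, ← sub_smul, Matrix.mul_smul, Matrix.smul_mul] at h
  rw [h, Matrix.smul_mul, smul_smul]
  congr 1
  field_simp
  ring

/-- The function `δ ↦ (1/T) tr (F Q̄(δ))` of the fixed-point equation. -/
noncomputable def traceMap (n : ℕ) (γ : ℝ) (F : Matrix (Fin T) (Fin T) ℝ) (x : ℝ) : ℝ :=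
  1 / (T : ℝ) * (F * RandomFeatures.Qbar n γ F x).trace

theorem traceMap_nonneg (hγ : 0 < γ) (hF : F.PosSemidef) {x : ℝ} (hx : 0 ≤ x) :
    0 ≤ traceMap n γ F x :=
  mul_nonneg (by positivity) (posSemidef_mul_Qbar hγ hF hx).trace_nonneg

theorem traceMap_le (hγ : 0 < γ) (hF : F.PosSemidef) {x : ℝ} (hx : 0 ≤ x) :
    traceMap n γ F x ≤ 1 / (T : ℝ) * (F.trace * (1 / γ)) := by
  refine mul_le_mul_of_nonneg_left ?_ (by positivity)
  refine (le_abs_self _).trans ((abs_trace_mul_le hF _).trans ?_)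
  exact mul_le_mul_of_nonneg_left (norm_Qbar_le hγ hF hx) hF.trace_nonneg

/-- The difference quotients of `traceMap` between `x` and `y` are nonnegative and at most
`traceMap y / (1 + y)`, which is less than `1` when `y` is a fixed point. -/
theorem exists_traceMap_sub_eq (hγ : 0 < γ) (hF : F.PosSemidef) {x y : ℝ} (hx : 0 ≤ x)
    (hy : 0 ≤ y) : ∃ θ, 0 ≤ θ ∧ θ ≤ traceMap n γ F y / (1 + y) ∧
      traceMap n γ F x - traceMap n γ F y = θ * (x - y) := by
  set c := (n : ℝ) / (T : ℝ) / (1 + x) with hc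
  have hc0 : 0 ≤ c := by positivity
  set Qx := RandomFeatures.Qbar n γ F x with hQx
  set Qy := RandomFeatures.Qbar n γ F y with hQy
  have hNx := posSemidef_mul_Qbar (n := n) hγ hF hx
  have hNy := posSemidef_mul_Qbar (n := n) hγ hF hy
  refine ⟨1 / (T : ℝ) * (c * ((F * Qx) * (F * Qy)).trace) / (1 + y), ?_, ?_, ?_⟩
  · have := trace_mul_nonneg hNx hNy
    positivity
  · have h1 : c * ((F * Qx) * (F * Qy)).trace = (F * Qy).trace - γ * (Qx * (F * Qy)).trace := by
      have h2 := smul_mul_Qbar (n := n) hγ hF hx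
      have h3 := congrArg (fun M => (M * (F * Qy)).trace) h2
      simpa [Matrix.smul_mul, sub_mul, Matrix.trace_smul, Matrix.trace_sub] using h3
    have h4 : 0 ≤ γ * (Qx * (F * Qy)).trace :=
      mul_nonneg hγ.le (trace_mul_nonneg (posSemidef_Qbar hγ hF hx) hNy)
    rw [traceMap, h1]
    gcongr
    linarith
  · rw [traceMap, traceMap, ← mul_sub, ← Matrix.trace_sub, ← mul_sub, Qbar_sub_Qbar hγ hF hx hy,
      Matrix.mul_smul, Matrix.smul_mul, Matrix.mul_smul, Matrix.trace_smul, Matrix.trace_smul,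
      smul_eq_mul, smul_eq_mul, ← hc]
    simp only [mul_assoc, ← hQx, ← hQy]
    field_simp

theorem traceMap_zero_pos (hγ : 0 < γ) (hF : F.PosSemidef) (h0 : F ≠ 0) :
    0 < traceMap n γ F 0 := by
  have hT : 0 < T := by
    rcases Nat.eq_zero_or_pos T with rfl | h
    · exact absurd (Subsingleton.elim _ _) h0
    · exact h
  have hG := posSemidef_smul_of_nonneg n hF le_rfl
  obtain ⟨B, hB, hsum⟩ := exists_trace_mul_eq_sum hF
  refine mul_pos (by positivity) (lt_of_le_of_ne ?_ fun h => h0 ?_)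
  · exact (posSemidef_mul_Qbar hγ hF le_rfl).trace_nonneg
  · rw [hsum] at h
    have h1 : ∀ k, B k = 0 := by
      intro k
      have h2 := (Finset.sum_eq_zero_iff_of_nonneg fun k _ =>
        dotProduct_mulVec_self_nonneg (posSemidef_Qbar (n := n) hγ hF le_rfl) (B k)).1 h.symm k
        (Finset.mem_univ k)
      rw [Qbar_eq_reg, dotProduct_reg_self hγ hG] at h2
      have h3 := dotProduct_mulVec_self_nonneg hG
        (reg γ (((n : ℝ) / (T : ℝ) / (1 + 0)) • F) *ᵥ B k)
      have h4 : l2 (reg γ (((n : ℝ) / (T : ℝ) / (1 + 0)) • F) *ᵥ B k) ^ 2 = 0 := by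
        nlinarith [sq_nonneg (l2 (reg γ (((n : ℝ) / (T : ℝ) / (1 + 0)) • F) *ᵥ B k))]
      rw [l2_sq, dotProduct_self_eq_zero] at h4
      have h5 := mulVec_reg_add hγ hG (B k)
      rw [h4] at h5
      simpa using h5.symm
    have h6 : B = 0 := funext h1
    rw [hB, h6, mul_zero]

theorem existsUnique_fixedPoint (hγ : 0 < γ) (hF : F.PosSemidef) (h0 : F ≠ 0) :
    ∃! δ : ℝ, 0 < δ ∧ RandomFeatures.FixedPoint n γ F δ := by
  set b := 1 / (T : ℝ) * (F.trace * (1 / γ)) with hb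
  have hb0 : 0 ≤ b := (traceMap_nonneg (n := n) hγ hF le_rfl).trans (traceMap_le hγ hF le_rfl)
  have hcont : ContinuousOn (traceMap n γ F) (Set.Icc 0 (b + 1)) := by
    refine (LipschitzOnWith.of_dist_le_mul (K := ⟨b, hb0⟩) fun x hx y hy => ?_).continuousOn
    obtain ⟨θ, hθ0, hθ, h⟩ := exists_traceMap_sub_eq (n := n) hγ hF hx.1 hy.1
    rw [Real.dist_eq, Real.dist_eq, h, abs_mul, abs_of_nonneg hθ0]
    refine mul_le_mul_of_nonneg_right ?_ (abs_nonneg _)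
    refine hθ.trans ((div_le_self (traceMap_nonneg hγ hF hy.1) (by linarith [hy.1])).trans ?_)
    exact traceMap_le hγ hF hy.1
  have hle : (0 : ℝ) ≤ b + 1 := by linarith
  obtain ⟨δ, hδ, hfix⟩ := intermediate_value_Icc' hle (hcont.sub continuousOn_id)
    (show (0 : ℝ) ∈ _ from ⟨by
      have := traceMap_le (n := n) hγ hF hle
      simp only [Pi.sub_apply, id]
      linarith, by simpa using traceMap_nonneg hγ hF le_rfl⟩)
  have hfix' : δ = traceMap n γ F δ := by
    simp only [Pi.sub_apply, id] at hfix
    linarith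
  refine ⟨δ, ⟨lt_of_le_of_ne hδ.1 fun h => ?_, hfix'⟩, fun x hx => ?_⟩
  · rw [← h] at hfix'
    exact (traceMap_zero_pos (n := n) hγ hF h0).ne hfix'
  · have hx' : x = traceMap n γ F x := hx.2
    obtain ⟨θ, -, hθ, h⟩ := exists_traceMap_sub_eq (n := n) hγ hF hx.1.le hδ.1
    rw [← hfix', ← hx'] at h
    rw [← hfix'] at hθ
    have hθ1 : θ < 1 := hθ.trans_lt ((div_lt_one (by linarith [hδ.1])).2 (by linarith))
    have h2 : (1 - θ) * (x - δ) = 0 := by linarith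
    rcases mul_eq_zero.1 h2 with h3 | h3 <;> linarith

/-- Stability: an approximate solution of the fixed-point equation gives nearly the same
deterministic equivalent as the exact one. -/
theorem norm_Qbar_sub_Qbar_le (hγ : 0 < γ) (hF : F.PosSemidef) {α δ : ℝ} (hα : 0 ≤ α) (hδ : 0 ≤ δ)
    (hfix : RandomFeatures.FixedPoint n γ F δ) :
    ‖RandomFeatures.Qbar n γ F α - RandomFeatures.Qbar n γ F δ‖ ≤
      1 / γ * |α - traceMap n γ F α| := by
  have hfix' : δ = traceMap n γ F δ := hfix
  obtain ⟨θ, hθ0, hθ, h⟩ := exists_traceMap_sub_eq (n := n) hγ hF hα hδ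
  rw [← hfix'] at hθ h
  have h1 : |α - δ| / (1 + δ) ≤ |α - traceMap n γ F α| := by
    have e : α - traceMap n γ F α = (1 - θ) * (α - δ) := by linarith
    have h2 : 1 / (1 + δ) ≤ 1 - θ := by
      have : 1 / (1 + δ) = 1 - δ / (1 + δ) := by field_simp; ring
      linarith
    have h3 : 0 ≤ 1 / (1 + δ) := by positivity
    rw [e, abs_mul, abs_of_nonneg (h3.trans h2), div_eq_mul_one_div, mul_comm]
    gcongr
  rw [Qbar_sub_Qbar hγ hF hα hδ, norm_smul, smul_Qbar_mul hγ hF hα, ← smul_mul_Qbar hγ hF hα,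
    Real.norm_eq_abs, abs_div, abs_of_nonneg (by linarith : 0 ≤ 1 + δ), mul_comm]
  refine mul_le_mul ?_ h1 (by positivity) (by positivity)
  refine (Matrix.l2_opNorm_mul _ _).trans ?_
  calc _ ≤ 1 * (1 / γ) := mul_le_mul (norm_smul_mul_Qbar_le hγ hF hα) (norm_Qbar_le hγ hF hδ)
        (norm_nonneg _) zero_le_one
    _ = 1 / γ := one_mul _

end FixedPoint

/-! ### Independent rows: resampling one row and exchanging two rows -/

section Rows

variable {α : Type*} [MeasurableSpace α] {ν : Measure α} [IsProbabilityMeasure ν] {n : ℕ}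

/-- Replacing one of the independent coordinates by an independent copy preserves the law. -/
theorem measurePreserving_update (i : Fin n) :
    MeasurePreserving (fun q : (Fin n → α) × α => Function.update q.1 i q.2)
      ((Measure.pi fun _ : Fin n => ν).prod ν) (Measure.pi fun _ : Fin n => ν) := by
  have hm : Measurable fun q : (Fin n → α) × α => Function.update q.1 i q.2 := by
    refine measurable_pi_lambda _ fun j => ?_
    by_cases h : j = i
    · subst h
      simpa using measurable_snd
    · simp only [Function.update_of_ne h]
      exact (measurable_pi_apply j).comp measurable_fst
  refine ⟨hm, (Measure.pi_eq fun A hA => ?_).symm⟩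
  have hpre : (fun q : (Fin n → α) × α => Function.update q.1 i q.2) ⁻¹' Set.univ.pi A =
      (Set.univ.pi (Function.update A i Set.univ)) ×ˢ A i := by
    ext q
    simp only [Set.mem_preimage, Set.mem_pi, Set.mem_univ, true_implies, Set.mem_prod]
    constructor
    · intro h
      refine ⟨fun j => ?_, by simpa using h i⟩
      by_cases hj : j = i
      · subst hj; simp
      · simpa [Function.update_of_ne hj] using h j
    · rintro ⟨h1, h2⟩ j
      by_cases hj : j = i
      · subst hj; simpa using h2
      · simpa [Function.update_of_ne hj] using h1 j
  rw [Measure.map_apply hm (MeasurableSet.univ_pi hA), hpre, Measure.prod_prod, Measure.pi_pi,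
    ← Finset.mul_prod_erase _ _ (Finset.mem_univ i),
    ← Finset.mul_prod_erase Finset.univ (fun j => ν (A j)) (Finset.mem_univ i)]
  rw [Function.update_self, measure_univ, one_mul, mul_comm]
  congr 1
  refine Finset.prod_congr rfl fun j hj => ?_
  rw [Function.update_of_ne (Finset.ne_of_mem_erase hj)]

theorem integral_update (i : Fin n) {f : (Fin n → α) → ℝ}
    (hf : Integrable f (Measure.pi fun _ : Fin n => ν)) :
    ∫ w, f w ∂(Measure.pi fun _ : Fin n => ν) =
      ∫ w, ∫ x, f (Function.update w i x) ∂ν ∂(Measure.pi fun _ : Fin n => ν) := by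
  have h := measurePreserving_update (ν := ν) i
  have hint : Integrable (fun q : (Fin n → α) × α => f (Function.update q.1 i q.2))
      ((Measure.pi fun _ : Fin n => ν).prod ν) :=
    (h.integrable_comp hf.aestronglyMeasurable).2 hf
  rw [← integral_prod _ hint]
  conv_lhs => rw [← h.map_eq]
  exact integral_map h.aemeasurable (by rw [h.map_eq]; exact hf.aestronglyMeasurable)

theorem integrable_update (i : Fin n) {f : (Fin n → α) → ℝ}
    (hf : Integrable f (Measure.pi fun _ : Fin n => ν)) :
    Integrable (fun w => ∫ x, f (Function.update w i x) ∂ν) (Measure.pi fun _ : Fin n => ν) := by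
  have h := measurePreserving_update (ν := ν) i
  exact ((h.integrable_comp hf.aestronglyMeasurable).2 hf).integral_prod_left

theorem integral_comp_perm (e : Equiv.Perm (Fin n)) (f : (Fin n → α) → ℝ) :
    ∫ w, f (fun j => w (e j)) ∂(Measure.pi fun _ : Fin n => ν) =
      ∫ w, f w ∂(Measure.pi fun _ : Fin n => ν) := by
  have h := (measurePreserving_piCongrLeft (fun _ : Fin n => ν) e).symm
  have h2 := h.integral_comp (MeasurableEquiv.measurableEmbedding _) f
  rw [← h2]
  rfl

end Rows

/-! ### The random Gram matrix and its resolvents -/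

section RandomGram

variable {E : Type*} {n T : ℕ}

/-- The matrix whose rows are the images under `s` of the entries of `W`. -/
def featRows (s : E → EuclideanSpace ℝ (Fin T)) (W : Fin n → E) : Matrix (Fin n) (Fin T) ℝ :=
  Matrix.of fun i => (s (W i)).ofLp

/-- The resolvent of the Gram matrix of all the rows. -/
noncomputable def fullRes (γ : ℝ) (s : E → EuclideanSpace ℝ (Fin T)) (W : Fin n → E) :
    Matrix (Fin T) (Fin T) ℝ :=
  reg γ (gram (featRows s W))

/-- The resolvent of the Gram matrix of the rows other than the `i`-th. -/
noncomputable def looRes (γ : ℝ) (s : E → EuclideanSpace ℝ (Fin T)) (i : Fin n) (W : Fin n → E) :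
    Matrix (Fin T) (Fin T) ℝ :=
  reg γ (gram ((featRows s W).updateRow i 0))

variable {s : E → EuclideanSpace ℝ (Fin T)} {K : ℝ≥0} {γ : ℝ}

theorem featRows_apply (W : Fin n → E) (i : Fin n) : featRows s W i = (s (W i)).ofLp := rfl

theorem looRes_update (i : Fin n) (W : Fin n → E) (x : E) :
    looRes γ s i (Function.update W i x) = looRes γ s i W := by
  rw [looRes, looRes]
  congr 2
  ext j a
  by_cases hj : j = i
  · subst hj; simp
  · simp [Matrix.updateRow_ne hj, featRows, Function.update_of_ne hj]

theorem rowForm_update (i : Fin n) (W : Fin n → E) (x : E) :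
    rowForm γ (featRows s (Function.update W i x)) i =
      1 / (T : ℝ) * ((s x).ofLp ⬝ᵥ looRes γ s i W *ᵥ (s x).ofLp) := by
  rw [← looRes_update i W x, rowForm, looRes, featRows_apply, Function.update_self]

theorem gram_featRows_perm (e : Equiv.Perm (Fin n)) (W : Fin n → E) :
    gram (featRows s fun j => W (e j)) = gram (featRows s W) := by
  rw [gram, gram]
  congr 1
  ext a b
  simp only [Matrix.mul_apply, Matrix.transpose_apply, featRows, Matrix.of_apply]
  exact Equiv.sum_comp e fun j => (s (W j)).ofLp a * (s (W j)).ofLp b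

theorem fullRes_perm (e : Equiv.Perm (Fin n)) (W : Fin n → E) :
    fullRes γ s (fun j => W (e j)) = fullRes γ s W := by
  rw [fullRes, gram_featRows_perm, fullRes]

theorem norm_looRes_le (hγ : 0 < γ) (i : Fin n) (W : Fin n → E) : ‖looRes γ s i W‖ ≤ 1 / γ :=
  norm_reg_le hγ (posSemidef_gram _)

theorem posSemidef_looRes (hγ : 0 < γ) (i : Fin n) (W : Fin n → E) :
    (looRes γ s i W).PosSemidef :=
  posSemidef_reg hγ (posSemidef_gram _)

theorem frob_updateRow_sub_le (S S' : Matrix (Fin n) (Fin T) ℝ) (i : Fin n) :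
    frob (S.updateRow i 0 - S'.updateRow i 0) ≤ frob (S - S') := by
  refine Real.sqrt_le_sqrt (Finset.sum_le_sum fun j _ => ?_)
  by_cases hj : j = i
  · subst hj
    have h : (S.updateRow j 0 - S'.updateRow j 0) j = 0 := by
      funext a
      simp
    rw [h]
    simp [l2]
  · have h : (S.updateRow i 0 - S'.updateRow i 0) j = (S - S') j := by
      funext a
      simp [Matrix.updateRow_ne hj]
    rw [h]

variable [NormedAddCommGroup E]

theorem frob_featRows_sub_le (hs : LipschitzWith K s) (w w' : PiLp 2 fun _ : Fin n => E) :
    frob (featRows s w.ofLp - featRows s w'.ofLp) ≤ K * ‖w - w'‖ := by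
  refine abs_le_of_sq_le_sq' ?_ (by positivity) |>.2
  rw [frob_sq, mul_pow, PiLp.norm_sq_eq_of_L2, Finset.mul_sum]
  refine Finset.sum_le_sum fun i _ => ?_
  rw [← mul_pow]
  refine pow_le_pow_left₀ (l2_nonneg _) ?_ 2
  have h := hs.dist_le_mul (w.ofLp i) (w'.ofLp i)
  rw [dist_eq_norm, dist_eq_norm] at h
  exact h

/-- The Lipschitz constant of the resolvent as a function of the rows. -/
noncomputable def resLip (γ : ℝ) (T : ℕ) (K : ℝ≥0) : ℝ := 2 / (γ * √γ * √T) * K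

theorem resLip_nonneg (hγ : 0 < γ) : 0 ≤ resLip γ T K := by
  unfold resLip
  positivity

theorem norm_fullRes_sub_le (hγ : 0 < γ) (hT : 0 < T) (hs : LipschitzWith K s)
    (w w' : PiLp 2 fun _ : Fin n => E) :
    ‖fullRes γ s w.ofLp - fullRes γ s w'.ofLp‖ ≤ resLip γ T K * ‖w - w'‖ := by
  refine (norm_reg_gram_sub_le hγ hT _ _).trans ?_
  rw [resLip, mul_assoc _ (K : ℝ), norm_sub_rev w]
  exact mul_le_mul_of_nonneg_left (frob_featRows_sub_le hs w' w) (by positivity)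

theorem norm_looRes_sub_le (hγ : 0 < γ) (hT : 0 < T) (hs : LipschitzWith K s) (i : Fin n)
    (w w' : PiLp 2 fun _ : Fin n => E) :
    ‖looRes γ s i w.ofLp - looRes γ s i w'.ofLp‖ ≤ resLip γ T K * ‖w - w'‖ := by
  refine (norm_reg_gram_sub_le hγ hT _ _).trans ?_
  rw [resLip, mul_assoc _ (K : ℝ), norm_sub_rev w]
  exact mul_le_mul_of_nonneg_left
    ((frob_updateRow_sub_le _ _ i).trans (frob_featRows_sub_le hs w' w)) (by positivity)

theorem lipschitzWith_dotProduct (hs : LipschitzWith K s) (u : Fin T → ℝ) :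
    LipschitzWith (K * (l2 u).toNNReal) fun x => (s x).ofLp ⬝ᵥ u := by
  refine LipschitzWith.of_dist_le_mul fun x y => ?_
  rw [Real.dist_eq, ← sub_dotProduct]
  refine (abs_dotProduct_le _ _).trans ?_
  have h := hs.dist_le_mul x y
  rw [dist_eq_norm] at h
  rw [NNReal.coe_mul, Real.coe_toNNReal _ (l2_nonneg u), mul_right_comm]
  exact mul_le_mul_of_nonneg_right h (l2_nonneg u)

variable [InnerProductSpace ℝ E] [FiniteDimensional ℝ E] [MeasurableSpace E]

/-- The second-moment matrix `E[s sᵀ]` of a row. -/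
noncomputable def secondMoment (s : E → EuclideanSpace ℝ (Fin T)) : Matrix (Fin T) (Fin T) ℝ :=
  RandomFeatures.expectation (stdGaussian E) fun x => Matrix.vecMulVec (s x).ofLp (s x).ofLp

/-- The mean `(1/T) tr (Φ M)` of the quadratic form `(1/T) sᵀ M s`. -/
noncomputable def meanForm (s : E → EuclideanSpace ℝ (Fin T)) (M : Matrix (Fin T) (Fin T) ℝ) : ℝ :=
  1 / (T : ℝ) * (secondMoment s * M).trace

theorem meanForm_sub (M N : Matrix (Fin T) (Fin T) ℝ) :
    meanForm s (M - N) = meanForm s M - meanForm s N := by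
  rw [meanForm, meanForm, meanForm, mul_sub, Matrix.trace_sub, mul_sub]

variable [BorelSpace E]

theorem LipschitzWith.allMoments_pi {f : (Fin n → E) → ℝ} {L : ℝ≥0}
    (hf : LipschitzWith L fun w : PiLp 2 (fun _ : Fin n => E) => f w.ofLp) :
    AllMoments f (Measure.pi fun _ : Fin n => stdGaussian E) :=
  hf.allMoments_stdGaussian.comp_measurePreserving measurePreserving_toLp_pi_stdGaussian

theorem allMoments_apply_of_lipschitz {M : (Fin n → E) → Matrix (Fin T) (Fin T) ℝ} {c : ℝ}
    (hM : ∀ w w' : PiLp 2 fun _ : Fin n => E, ‖M w.ofLp - M w'.ofLp‖ ≤ c * ‖w - w'‖)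
    (a b : Fin T) : AllMoments (fun W => M W a b) (Measure.pi fun _ : Fin n => stdGaussian E) := by
  refine LipschitzWith.allMoments_pi (L := c.toNNReal)
    (LipschitzWith.of_dist_le_mul fun w w' => ?_)
  have h1 : M w.ofLp a b - M w'.ofLp a b =
      Pi.single a 1 ⬝ᵥ (M w.ofLp - M w'.ofLp) *ᵥ Pi.single b 1 := by simp
  have h2 := abs_dotProduct_mulVec_le (M w.ofLp - M w'.ofLp) (Pi.single a 1) (Pi.single b 1)
  have h3 : ∀ a : Fin T, l2 (Pi.single a (1 : ℝ)) = 1 := fun a => by simp [l2]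
  rw [← h1, h3, h3, mul_one, mul_one] at h2
  rw [Real.dist_eq, dist_eq_norm]
  refine h2.trans ((hM w w').trans ?_)
  exact mul_le_mul_of_nonneg_right (Real.le_coe_toNNReal c) (norm_nonneg _)

theorem allMoments_fullRes (hγ : 0 < γ) (hT : 0 < T) (hs : LipschitzWith K s) (a b : Fin T) :
    AllMoments (fun W => fullRes γ s W a b) (Measure.pi fun _ : Fin n => stdGaussian E) :=
  allMoments_apply_of_lipschitz (norm_fullRes_sub_le hγ hT hs) a b

theorem allMoments_looRes (hγ : 0 < γ) (hT : 0 < T) (hs : LipschitzWith K s) (i : Fin n)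
    (a b : Fin T) :
    AllMoments (fun W => looRes γ s i W a b) (Measure.pi fun _ : Fin n => stdGaussian E) :=
  allMoments_apply_of_lipschitz (norm_looRes_sub_le hγ hT hs i) a b

theorem allMoments_dotProduct (hs : LipschitzWith K s) (u : Fin T → ℝ) :
    AllMoments (fun x => (s x).ofLp ⬝ᵥ u) (stdGaussian E) :=
  (lipschitzWith_dotProduct hs u).allMoments_stdGaussian

theorem allMoments_coord (hs : LipschitzWith K s) (a : Fin T) :
    AllMoments (fun x => (s x).ofLp a) (stdGaussian E) := by
  simpa using allMoments_dotProduct hs (Pi.single a 1)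

theorem allMoments_row (hs : LipschitzWith K s) (i : Fin n) (a : Fin T) :
    AllMoments (fun W => featRows s W i a) (Measure.pi fun _ : Fin n => stdGaussian E) :=
  (allMoments_coord hs a).comp_measurePreserving
    (measurePreserving_eval (fun _ : Fin n => stdGaussian E) i)

section MatrixMoments

variable {α : Type*} [MeasurableSpace α] {P : Measure α}
  {M : α → Matrix (Fin T) (Fin T) ℝ} {u v : α → Fin T → ℝ}

theorem AllMoments.dotProduct (hu : ∀ a, AllMoments (fun x => u x a) P)
    (hv : ∀ a, AllMoments (fun x => v x a) P) : AllMoments (fun x => u x ⬝ᵥ v x) P :=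
  AllMoments.sum _ fun a _ => (hu a).mul (hv a)

theorem AllMoments.mulVec (hM : ∀ a b, AllMoments (fun x => M x a b) P)
    (hv : ∀ a, AllMoments (fun x => v x a) P) (a : Fin T) :
    AllMoments (fun x => (M x *ᵥ v x) a) P :=
  AllMoments.dotProduct (hM a) hv

/-- Bilinear forms commute with entry-wise expectations. -/
theorem integral_dotProduct_mulVec (hM : ∀ a b, Integrable (fun x => M x a b) P)
    (u v : Fin T → ℝ) :
    ∫ x, u ⬝ᵥ M x *ᵥ v ∂P = u ⬝ᵥ (RandomFeatures.expectation P M) *ᵥ v := by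
  simp only [dotProduct, Matrix.mulVec, RandomFeatures.expectation, Matrix.of_apply]
  rw [integral_finsetSum _ fun a _ => (integrable_finsetSum _ fun b _ =>
    (hM a b).mul_const _).const_mul _]
  refine Finset.sum_congr rfl fun a _ => ?_
  rw [integral_const_mul, integral_finsetSum _ fun b _ => (hM a b).mul_const _]
  congr 1
  exact Finset.sum_congr rfl fun b _ => integral_mul_const _ _

theorem norm_expectation_le [IsProbabilityMeasure P] (hM : ∀ a b, Integrable (fun x => M x a b) P)
    {C : ℝ} (hC : 0 ≤ C) (h : ∀ x, ‖M x‖ ≤ C) : ‖RandomFeatures.expectation P M‖ ≤ C := by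
  refine norm_le_of_bilin hC fun u v => ?_
  rw [← integral_dotProduct_mulVec hM]
  have h1 := norm_integral_le_of_norm_le_const (μ := P) (f := fun x => u ⬝ᵥ M x *ᵥ v)
    (C := C * l2 u * l2 v) (Eventually.of_forall fun x => (abs_dotProduct_mulVec_le _ u v).trans
      (by have := l2_nonneg u; have := l2_nonneg v; gcongr; exact h x))
  simpa using h1

end MatrixMoments

theorem dotProduct_secondMoment (hs : LipschitzWith K s) (u v : Fin T → ℝ) :
    u ⬝ᵥ secondMoment s *ᵥ v =
      ∫ x, ((s x).ofLp ⬝ᵥ u) * ((s x).ofLp ⬝ᵥ v) ∂(stdGaussian E) := by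
  rw [secondMoment, ← integral_dotProduct_mulVec]
  · refine integral_congr_ae (Eventually.of_forall fun x => ?_)
    simp only
    rw [dotProduct_rankOne, dotProduct_comm u]
  · intro a b
    simp only [Matrix.vecMulVec_apply]
    exact ((allMoments_coord hs a).mul (allMoments_coord hs b)).integrable

theorem trace_secondMoment_mul (hs : LipschitzWith K s) (M : Matrix (Fin T) (Fin T) ℝ) :
    (secondMoment s * M).trace = ∫ x, (s x).ofLp ⬝ᵥ M *ᵥ (s x).ofLp ∂(stdGaussian E) := by
  have hint : ∀ a b, Integrable (fun x => (s x).ofLp a * (M a b * (s x).ofLp b))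
      (stdGaussian E) := fun a b =>
    ((allMoments_coord hs a).mul ((allMoments_coord hs b).const_mul _)).integrable
  simp only [dotProduct, Matrix.mulVec, Finset.mul_sum]
  rw [integral_finsetSum _ fun a _ => integrable_finsetSum _ fun b _ => hint a b,
    Matrix.trace_mul_comm, Matrix.trace]
  refine Finset.sum_congr rfl fun a _ => ?_
  rw [integral_finsetSum _ fun b _ => hint a b, Matrix.diag_apply, Matrix.mul_apply]
  refine Finset.sum_congr rfl fun b _ => ?_
  simp only [secondMoment, RandomFeatures.expectation, Matrix.of_apply, Matrix.vecMulVec_apply]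
  rw [← integral_const_mul]
  refine integral_congr_ae (Eventually.of_forall fun x => ?_)
  simp only
  ring

theorem posSemidef_secondMoment (hs : LipschitzWith K s) : (secondMoment s).PosSemidef := by
  refine Matrix.PosSemidef.of_dotProduct_mulVec_nonneg ?_ fun u => ?_
  · ext a b
    simp [secondMoment, RandomFeatures.expectation, Matrix.vecMulVec_apply, mul_comm]
  · rw [star_trivial, dotProduct_secondMoment hs]
    exact integral_nonneg fun x => mul_self_nonneg _

theorem abs_meanForm_le (hs : LipschitzWith K s) {B : ℝ}
    (hB : 1 / (T : ℝ) * (secondMoment s).trace ≤ B) (M : Matrix (Fin T) (Fin T) ℝ) :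
    |meanForm s M| ≤ B * ‖M‖ := by
  rw [meanForm, abs_mul, abs_of_nonneg (by positivity)]
  calc _ ≤ 1 / (T : ℝ) * ((secondMoment s).trace * ‖M‖) :=
        mul_le_mul_of_nonneg_left (abs_trace_mul_le (posSemidef_secondMoment hs) M) (by positivity)
    _ = 1 / (T : ℝ) * (secondMoment s).trace * ‖M‖ := by ring
    _ ≤ _ := by gcongr

theorem meanForm_nonneg (hs : LipschitzWith K s) {M : Matrix (Fin T) (Fin T) ℝ}
    (hM : M.PosSemidef) : 0 ≤ meanForm s M :=
  mul_nonneg (by positivity) (trace_mul_nonneg (posSemidef_secondMoment hs) hM)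

end RandomGram

/-! ### Concentration of the quadratic forms of the rows -/

section Deviation

variable {E : Type*} [NormedAddCommGroup E] [InnerProductSpace ℝ E] [FiniteDimensional ℝ E]
  [MeasurableSpace E] [BorelSpace E] {n T : ℕ} {s : E → EuclideanSpace ℝ (Fin T)} {K : ℝ≥0}
  {γ B : ℝ}

/-- The constant in the fourth-moment bound for quadratic forms. -/
noncomputable def quadConst (γ B : ℝ) (K : ℝ≥0) : ℝ :=
  27 * (16 * (B / γ) ^ 2 * (concConst 4 * K ^ 4 / γ ^ 2) + 2 * (concConst 8 * K ^ 8 / γ ^ 4))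

/-- The quadratic form `(1/T) sᵀ M s` of a random row concentrates. It is the square of the
Lipschitz function `‖M^{1/2} s‖ / √T`, whose Lipschitz constant is of order `T^{-1/2}`. -/
theorem integral_quadForm_sub_pow_four_le (hγ : 0 < γ) (hT : 0 < T) (hs : LipschitzWith K s)
    (hB : 1 / (T : ℝ) * (secondMoment s).trace ≤ B) {M : Matrix (Fin T) (Fin T) ℝ}
    (hM : M.PosSemidef) (hMn : ‖M‖ ≤ 1 / γ) :
    ∫ x, (1 / (T : ℝ) * ((s x).ofLp ⬝ᵥ M *ᵥ (s x).ofLp) - meanForm s M) ^ 4 ∂(stdGaussian E) ≤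
      quadConst γ B K / (T : ℝ) ^ 2 := by
  have hT' : (0 : ℝ) < T := by exact_mod_cast hT
  have hT1 : (1 : ℝ) ≤ T := by exact_mod_cast hT
  obtain ⟨A, hA, -⟩ := exists_trace_mul_eq_sum hM
  have hAq : ∀ z : Fin T → ℝ, l2 (A *ᵥ z) ^ 2 = z ⬝ᵥ M *ᵥ z := by
    intro z
    rw [l2_sq, hA, ← Matrix.mulVec_mulVec, Matrix.dotProduct_mulVec z, Matrix.vecMul_transpose]
  have hAn : ∀ z : Fin T → ℝ, l2 (A *ᵥ z) ≤ √(1 / γ) * l2 z := by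
    intro z
    refine abs_le_of_sq_le_sq' ?_ (mul_nonneg (Real.sqrt_nonneg _) (l2_nonneg z)) |>.2
    rw [hAq, mul_pow, Real.sq_sqrt (by positivity), sq (l2 z), ← mul_assoc]
    refine (le_abs_self _).trans ((abs_dotProduct_mulVec_le M z z).trans ?_)
    have := l2_nonneg z
    gcongr
  set r : E → ℝ := fun x => √(1 / (T : ℝ)) * l2 (A *ᵥ (s x).ofLp) with hr
  set L : ℝ≥0 := ⟨√(1 / (T : ℝ)) * √(1 / γ), by positivity⟩ * K with hL
  have hLval : (L : ℝ) = √(1 / (T : ℝ)) * √(1 / γ) * K := rfl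
  have hlip : LipschitzWith L r := by
    refine LipschitzWith.of_dist_le_mul fun x y => ?_
    have h1 : |l2 (A *ᵥ (s x).ofLp) - l2 (A *ᵥ (s y).ofLp)| ≤
        l2 (A *ᵥ ((s x).ofLp - (s y).ofLp)) := by
      rw [Matrix.mulVec_sub]
      exact abs_norm_sub_norm_le (WithLp.toLp 2 (A *ᵥ (s x).ofLp)) (WithLp.toLp 2 (A *ᵥ (s y).ofLp))
    have h2 := hs.dist_le_mul x y
    rw [dist_eq_norm] at h2
    have h3 : l2 ((s x).ofLp - (s y).ofLp) ≤ K * dist x y := h2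
    rw [Real.dist_eq, hr, ← mul_sub, abs_mul, abs_of_nonneg (Real.sqrt_nonneg _), hLval]
    calc _ ≤ √(1 / (T : ℝ)) * (√(1 / γ) * (K * dist x y)) := by
          gcongr
          exact h1.trans ((hAn _).trans (by gcongr))
      _ = _ := by ring
  have hL2 : (L : ℝ) ^ 2 = K ^ 2 / (γ * T) := by
    rw [hLval, mul_pow, mul_pow, Real.sq_sqrt (by positivity), Real.sq_sqrt (by positivity)]
    field_simp
  have hr2 : ∀ x, r x ^ 2 = 1 / (T : ℝ) * ((s x).ofLp ⬝ᵥ M *ᵥ (s x).ofLp) := by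
    intro x
    rw [hr, mul_pow, Real.sq_sqrt (by positivity), hAq]
  have hmean : ∫ x, r x ^ 2 ∂(stdGaussian E) = meanForm s M := by
    simp_rw [hr2]
    rw [integral_const_mul, ← trace_secondMoment_mul hs, meanForm]
  have hmB : ∫ x, r x ^ 2 ∂(stdGaussian E) ≤ B / γ := by
    rw [hmean]
    have hB0 : 0 ≤ B := le_trans (mul_nonneg (by positivity)
      (posSemidef_secondMoment hs).trace_nonneg) hB
    refine (le_abs_self _).trans ((abs_meanForm_le hs hB M).trans ?_)
    rw [div_eq_mul_one_div]
    gcongr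
  have h4 : ∫ x, (r x - ∫ y, r y ∂(stdGaussian E)) ^ 4 ∂(stdGaussian E) ≤
      concConst 4 * K ^ 4 / γ ^ 2 / (T : ℝ) ^ 2 := by
    refine (integral_sub_mean_pow_le hlip (by decide)).trans (le_of_eq ?_)
    rw [show (L : ℝ) ^ 4 = ((L : ℝ) ^ 2) ^ 2 by ring, hL2]
    field_simp
  have h8 : ∫ x, (r x - ∫ y, r y ∂(stdGaussian E)) ^ 8 ∂(stdGaussian E) ≤
      concConst 8 * K ^ 8 / γ ^ 4 / (T : ℝ) ^ 2 := by
    refine (integral_sub_mean_pow_le hlip (by decide)).trans ?_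
    rw [show (L : ℝ) ^ 8 = ((L : ℝ) ^ 2) ^ 4 by ring, hL2]
    have h5 : concConst 8 * ((K : ℝ) ^ 2 / (γ * T)) ^ 4 =
        concConst 8 * K ^ 8 / γ ^ 4 / (T : ℝ) ^ 4 := by
      field_simp
    rw [h5]
    have := concConst_nonneg 8
    gcongr
    norm_num
  have h := hlip.allMoments_stdGaussian.integral_sq_sub_pow_four_le hmB h4 h8
  rw [hmean] at h
  simp_rw [hr2] at h
  refine h.trans (le_of_eq ?_)
  rw [quadConst]
  ring

/-- The constant in the fourth-moment bound for the deviation of `rowForm` from its mean. -/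
noncomputable def devConst (γ B : ℝ) (K : ℝ≥0) : ℝ :=
  8 * (quadConst γ B K + concConst 4 * (B * (2 / (γ * √γ)) * K) ^ 4)

theorem lipschitzWith_meanForm_looRes (hγ : 0 < γ) (hT : 0 < T) (hs : LipschitzWith K s)
    (hB0 : 0 ≤ B) (hB : 1 / (T : ℝ) * (secondMoment s).trace ≤ B) (i : Fin n) :
    LipschitzWith (B * resLip γ T K).toNNReal
      fun w : PiLp 2 (fun _ : Fin n => E) => meanForm s (looRes γ s i w.ofLp) := by
  refine LipschitzWith.of_dist_le_mul fun w w' => ?_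
  rw [Real.dist_eq, ← meanForm_sub, dist_eq_norm,
    Real.coe_toNNReal _ (mul_nonneg hB0 (resLip_nonneg hγ)), mul_assoc]
  exact (abs_meanForm_le hs hB _).trans
    (mul_le_mul_of_nonneg_left (norm_looRes_sub_le hγ hT hs i w w') hB0)

/-- The mean of `rowForm`, which is `(1/T) tr (Φ E[Q₋])`. -/
noncomputable def meanRowForm (γ : ℝ) (s : E → EuclideanSpace ℝ (Fin T)) (i : Fin n) : ℝ :=
  ∫ W, meanForm s (looRes γ s i W) ∂(Measure.pi fun _ : Fin n => stdGaussian E)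

theorem allMoments_rowForm (hγ : 0 < γ) (hT : 0 < T) (hs : LipschitzWith K s) (i : Fin n) :
    AllMoments (fun W => rowForm γ (featRows s W) i)
      (Measure.pi fun _ : Fin n => stdGaussian E) :=
  (AllMoments.dotProduct (allMoments_row hs i) (AllMoments.mulVec (allMoments_looRes hγ hT hs i)
    (allMoments_row hs i))).const_mul _

/-- The quadratic form of a row with the resolvent of the others concentrates around its mean, with
respect to all the rows. -/
theorem integral_rowForm_sub_pow_four_le (hγ : 0 < γ) (hT : 0 < T) (hs : LipschitzWith K s)
    (hB0 : 0 ≤ B) (hB : 1 / (T : ℝ) * (secondMoment s).trace ≤ B) (i : Fin n) :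
    ∫ W, (rowForm γ (featRows s W) i - meanRowForm γ s i) ^ 4
      ∂(Measure.pi fun _ : Fin n => stdGaussian E) ≤ devConst γ B K / (T : ℝ) ^ 2 := by
  have hT' : (0 : ℝ) < T := by exact_mod_cast hT
  set μ := Measure.pi fun _ : Fin n => stdGaussian E with hμ
  have hlip := lipschitzWith_meanForm_looRes (n := n) hγ hT hs hB0 hB i
  have hm : AllMoments (fun W => meanForm s (looRes γ s i W)) μ := hlip.allMoments_pi
  have hd := allMoments_rowForm (n := n) hγ hT hs i
  -- fluctuations due to the `i`-th row, the other rows being fixed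
  have h1 : ∫ W, (rowForm γ (featRows s W) i - meanForm s (looRes γ s i W)) ^ 4 ∂μ ≤
      quadConst γ B K / (T : ℝ) ^ 2 := by
    have hint := ((hd.sub hm).pow 4).integrable
    rw [integral_update i hint]
    have h3 : ∀ W : Fin n → E, ∫ x, (rowForm γ (featRows s (Function.update W i x)) i -
        meanForm s (looRes γ s i (Function.update W i x))) ^ 4 ∂(stdGaussian E) ≤
        quadConst γ B K / (T : ℝ) ^ 2 := by
      intro W
      simp only [rowForm_update, looRes_update]
      exact integral_quadForm_sub_pow_four_le hγ hT hs hB (posSemidef_looRes hγ i W)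
        (norm_looRes_le hγ i W)
    refine (integral_mono (integrable_update i hint) (integrable_const _) h3).trans ?_
    simp
  -- fluctuations due to the other rows
  have h2 : ∫ W, (meanForm s (looRes γ s i W) - meanRowForm γ s i) ^ 4 ∂μ ≤
      concConst 4 * (B * (2 / (γ * √γ)) * K) ^ 4 / (T : ℝ) ^ 2 := by
    refine (integral_pi_sub_mean_pow_le hlip (p := 4) (by decide)).trans (le_of_eq ?_)
    rw [Real.coe_toNNReal _ (mul_nonneg hB0 (resLip_nonneg hγ)), resLip]
    have h4 : (T : ℝ) ^ 2 = √(T : ℝ) ^ 4 := by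
      rw [show √(T : ℝ) ^ 4 = (√(T : ℝ) ^ 2) ^ 2 by ring, Real.sq_sqrt hT'.le]
    rw [h4]
    field_simp
  have hi1 := (hd.sub hm).pow 4
  have hi2 := (hm.sub (AllMoments.const (meanRowForm γ s i))).pow 4
  calc _ ≤ ∫ W, 8 * ((rowForm γ (featRows s W) i - meanForm s (looRes γ s i W)) ^ 4 +
        (meanForm s (looRes γ s i W) - meanRowForm γ s i) ^ 4) ∂μ := by
        refine integral_mono ((hd.sub (.const _)).pow 4).integrable
          ((hi1.add hi2).const_mul 8).integrable fun W => ?_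
        simp only
        refine le_trans (le_of_eq ?_) (add_pow_four_le _ _)
        ring
    _ = 8 * ((∫ W, (rowForm γ (featRows s W) i - meanForm s (looRes γ s i W)) ^ 4 ∂μ) +
        ∫ W, (meanForm s (looRes γ s i W) - meanRowForm γ s i) ^ 4 ∂μ) := by
        rw [integral_const_mul, integral_add hi1.integrable hi2.integrable]
    _ ≤ 8 * (quadConst γ B K / (T : ℝ) ^ 2 +
        concConst 4 * (B * (2 / (γ * √γ)) * K) ^ 4 / (T : ℝ) ^ 2) := by gcongr
    _ = _ := by
        rw [devConst]
        ring

theorem meanRowForm_nonneg (hγ : 0 < γ) (hs : LipschitzWith K s) (i : Fin n) :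
    0 ≤ meanRowForm γ s i :=
  integral_nonneg fun W => meanForm_nonneg hs (posSemidef_looRes hγ i W)

end Deviation

/-! ### The expected resolvent -/

section ExpectedResolvent

variable {E : Type*} [NormedAddCommGroup E] [InnerProductSpace ℝ E] [FiniteDimensional ℝ E]
  [MeasurableSpace E] [BorelSpace E] {n T : ℕ} {s : E → EuclideanSpace ℝ (Fin T)} {K : ℝ≥0}
  {γ B : ℝ}

/-- The rows are exchangeable, and the resolvent is a symmetric function of them. -/
theorem integral_row_eq (i j : Fin n) (f : (Fin T → ℝ) → Matrix (Fin T) (Fin T) ℝ → ℝ) :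
    ∫ W, f (featRows s W j) (fullRes γ s W) ∂(Measure.pi fun _ : Fin n => stdGaussian E) =
      ∫ W, f (featRows s W i) (fullRes γ s W) ∂(Measure.pi fun _ : Fin n => stdGaussian E) := by
  have h := integral_comp_perm (ν := stdGaussian E) (Equiv.swap i j)
    fun W => f (featRows s W i) (fullRes γ s W)
  simp only [fullRes_perm, featRows_apply, Equiv.swap_apply_left] at h
  exact h

theorem allMoments_fullRes_row (hγ : 0 < γ) (hT : 0 < T) (hs : LipschitzWith K s)
    (u : Fin T → ℝ) (i : Fin n) :
    AllMoments (fun W => u ⬝ᵥ fullRes γ s W *ᵥ featRows s W i)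
      (Measure.pi fun _ : Fin n => stdGaussian E) :=
  AllMoments.dotProduct (u := fun _ => u) (fun _ => .const _)
    (AllMoments.mulVec (allMoments_fullRes hγ hT hs) (allMoments_row hs i))

theorem allMoments_row_dotProduct (hs : LipschitzWith K s) (w : Fin T → ℝ) (i : Fin n) :
    AllMoments (fun W => featRows s W i ⬝ᵥ w) (Measure.pi fun _ : Fin n => stdGaussian E) :=
  AllMoments.dotProduct (v := fun _ => w) (allMoments_row hs i) (fun _ => .const _)

/-- By exchangeability every row contributes the same, and the sum over all rows is bounded by
`sum_sq_row_le`. -/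
theorem integral_sq_fullRes_row_le (hγ : 0 < γ) (hT : 0 < T) (hs : LipschitzWith K s)
    {u : Fin T → ℝ} (hu : l2 u = 1) (i : Fin n) :
    ∫ W, (u ⬝ᵥ fullRes γ s W *ᵥ featRows s W i) ^ 2
      ∂(Measure.pi fun _ : Fin n => stdGaussian E) ≤ T / (n * γ) := by
  have hT' : (0 : ℝ) < T := by exact_mod_cast hT
  have hn' : (0 : ℝ) < n := by exact_mod_cast i.pos
  set μ := Measure.pi fun _ : Fin n => stdGaussian E
  have h1 : ∫ W, ∑ j, (u ⬝ᵥ fullRes γ s W *ᵥ featRows s W j) ^ 2 ∂μ ≤ T / γ := by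
    have h2 : ∀ W : Fin n → E, ∑ j, (u ⬝ᵥ fullRes γ s W *ᵥ featRows s W j) ^ 2 ≤ T / γ := by
      intro W
      have h3 := sum_sq_row_le hγ (featRows s W) u
      rw [hu, one_pow, mul_one, div_mul_eq_mul_div, one_mul, div_le_iff₀ hT'] at h3
      exact h3.trans (le_of_eq (by ring))
    refine (integral_mono (integrable_finsetSum _ fun j _ =>
      ((allMoments_fullRes_row hγ hT hs u j).pow 2).integrable) (integrable_const _) h2).trans ?_
    simp
  rw [integral_finsetSum _ fun j _ =>
      ((allMoments_fullRes_row hγ hT hs u j).pow 2).integrable,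
    Finset.sum_congr rfl fun j _ => integral_row_eq (s := s) (γ := γ) i j
      fun x Q => (u ⬝ᵥ Q *ᵥ x) ^ 2] at h1
  rw [Finset.sum_const, Finset.card_univ, Fintype.card_fin, nsmul_eq_mul] at h1
  rw [mul_comm (n : ℝ), ← div_div, le_div_iff₀ hn']
  linarith

/-- Removing one row hardly changes the expected resolvent. -/
theorem norm_expectation_looRes_sub_fullRes_le (hγ : 0 < γ) (hT : 0 < T) (hs : LipschitzWith K s)
    (i : Fin n) {α η : ℝ} (hα : 0 ≤ α) (hη : 0 ≤ η)
    (hdev : ∫ W, (rowForm γ (featRows s W) i - α) ^ 4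
      ∂(Measure.pi fun _ : Fin n => stdGaussian E) ≤ η ^ 4) :
    ‖RandomFeatures.expectation (Measure.pi fun _ : Fin n => stdGaussian E) (looRes γ s i) -
      RandomFeatures.expectation (Measure.pi fun _ : Fin n => stdGaussian E) (fullRes γ s)‖ ≤
      (1 + α) / (n * γ) + η / γ := by
  have hT' : (0 : ℝ) < T := by exact_mod_cast hT
  have hn' : (0 : ℝ) < n := by exact_mod_cast i.pos
  set μ := Measure.pi fun _ : Fin n => stdGaussian E
  have hd := (allMoments_rowForm (n := n) hγ hT hs i).sub (AllMoments.const α)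
  have habs : ∫ W, |rowForm γ (featRows s W) i - α| ∂μ ≤ η := by
    refine le_of_pow_le_pow_left₀ (n := 4) (by norm_num) hη ?_
    refine (hd.abs.pow_integral_le (by decide : Even 4)).trans (le_trans (le_of_eq ?_) hdev)
    exact integral_congr_ae (Eventually.of_forall fun W => Even.pow_abs (by decide) _)
  have hquad : ∀ u : Fin T → ℝ, l2 u = 1 →
      ∫ W, (1 + rowForm γ (featRows s W) i) * (1 / (T : ℝ)) *
        (u ⬝ᵥ fullRes γ s W *ᵥ featRows s W i) ^ 2 ∂μ ≤ (1 + α) / (n * γ) + η / γ := by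
    intro u hu
    have hY := allMoments_fullRes_row (n := n) hγ hT hs u i
    have hpt : ∀ W : Fin n → E, (1 + rowForm γ (featRows s W) i) * (1 / (T : ℝ)) *
        (u ⬝ᵥ fullRes γ s W *ᵥ featRows s W i) ^ 2 ≤
        (1 + α) / T * (u ⬝ᵥ fullRes γ s W *ᵥ featRows s W i) ^ 2 +
          1 / γ * |rowForm γ (featRows s W) i - α| := by
      intro W
      have h1 : 1 / (T : ℝ) * (u ⬝ᵥ fullRes γ s W *ᵥ featRows s W i) ^ 2 ≤ 1 / γ := by
        have h3 := sum_sq_row_le hγ (featRows s W) u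
        rw [hu, one_pow, mul_one] at h3
        refine le_trans ?_ h3
        refine mul_le_mul_of_nonneg_left ?_ (by positivity)
        exact Finset.single_le_sum
          (f := fun j => (u ⬝ᵥ fullRes γ s W *ᵥ featRows s W j) ^ 2)
          (fun j _ => sq_nonneg _) (Finset.mem_univ i)
      have h2 : (rowForm γ (featRows s W) i - α) *
          (1 / (T : ℝ) * (u ⬝ᵥ fullRes γ s W *ᵥ featRows s W i) ^ 2) ≤
          1 / γ * |rowForm γ (featRows s W) i - α| := by
        rw [mul_comm (1 / γ)]
        exact mul_le_mul (le_abs_self _) h1 (by positivity) (abs_nonneg _)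
      calc _ = (1 + α) / T * (u ⬝ᵥ fullRes γ s W *ᵥ featRows s W i) ^ 2 +
          (rowForm γ (featRows s W) i - α) *
            (1 / (T : ℝ) * (u ⬝ᵥ fullRes γ s W *ᵥ featRows s W i) ^ 2) := by ring
        _ ≤ _ := by linarith
    have hi1 := (hY.pow 2).const_mul ((1 + α) / T)
    have hi2 := hd.abs.const_mul (1 / γ)
    have hi0 := (((AllMoments.const (1 : ℝ)).add (allMoments_rowForm (n := n) hγ hT hs i)).mul
      (AllMoments.const (1 / (T : ℝ)))).mul (hY.pow 2)
    refine (integral_mono hi0.integrable (hi1.add hi2).integrable hpt).trans ?_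
    rw [integral_add hi1.integrable hi2.integrable, integral_const_mul, integral_const_mul]
    refine add_le_add ?_ ?_
    · calc _ ≤ (1 + α) / T * (T / (n * γ)) := mul_le_mul_of_nonneg_left
            (integral_sq_fullRes_row_le hγ hT hs hu i) (by positivity)
        _ = _ := by field_simp
    · rw [div_eq_mul_one_div η, mul_comm η]
      exact mul_le_mul_of_nonneg_left habs (by positivity)
  refine norm_le_of_unit_bilin (by positivity) fun u v hu hv => ?_
  have hdiff : ∀ a b, AllMoments (fun W : Fin n → E => (looRes γ s i W - fullRes γ s W) a b) μ :=
    fun a b => (allMoments_looRes hγ hT hs i a b).sub (allMoments_fullRes hγ hT hs a b)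
  have hexp : RandomFeatures.expectation μ (looRes γ s i) -
      RandomFeatures.expectation μ (fullRes γ s) =
      RandomFeatures.expectation μ fun W => looRes γ s i W - fullRes γ s W := by
    ext a b
    exact (integral_sub (allMoments_looRes hγ hT hs i a b).integrable
      (allMoments_fullRes hγ hT hs a b).integrable).symm
  rw [hexp, ← integral_dotProduct_mulVec fun a b => (hdiff a b).integrable]
  have hY : ∀ u, AllMoments (fun W : Fin n → E => (1 + rowForm γ (featRows s W) i) *
      (1 / (T : ℝ)) * (u ⬝ᵥ fullRes γ s W *ᵥ featRows s W i) ^ 2) μ := fun u =>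
    (((AllMoments.const (1 : ℝ)).add (allMoments_rowForm (n := n) hγ hT hs i)).mul
      (AllMoments.const (1 / (T : ℝ)))).mul ((allMoments_fullRes_row (n := n) hγ hT hs u i).pow 2)
  have hb : ∀ W : Fin n → E, ‖u ⬝ᵥ (looRes γ s i W - fullRes γ s W) *ᵥ v‖ ≤
      1 / 2 * ((1 + rowForm γ (featRows s W) i) * (1 / (T : ℝ)) *
          (u ⬝ᵥ fullRes γ s W *ᵥ featRows s W i) ^ 2 +
        (1 + rowForm γ (featRows s W) i) * (1 / (T : ℝ)) *
          (v ⬝ᵥ fullRes γ s W *ᵥ featRows s W i) ^ 2) := by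
    intro W
    have h1 := dotProduct_reg_updateRow_sub hγ (featRows s W) i u v
    rw [looRes, fullRes, h1, Real.norm_eq_abs, mul_assoc _ (_ ⬝ᵥ _), abs_mul,
      abs_of_nonneg (mul_nonneg (by linarith [rowForm_nonneg hγ (featRows s W) i])
        (by positivity))]
    set c := (1 + rowForm γ (featRows s W) i) * (1 / (T : ℝ)) with hc
    have hc0 : 0 ≤ c :=
      mul_nonneg (by linarith [rowForm_nonneg hγ (featRows s W) i]) (by positivity)
    set y := u ⬝ᵥ reg γ (gram (featRows s W)) *ᵥ featRows s W i
    set z := v ⬝ᵥ reg γ (gram (featRows s W)) *ᵥ featRows s W i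
    have h2 : |y * z| ≤ 1 / 2 * (y ^ 2 + z ^ 2) := by
      rw [abs_le]
      constructor <;> nlinarith [sq_nonneg (y - z), sq_nonneg (y + z)]
    calc _ ≤ c * (1 / 2 * (y ^ 2 + z ^ 2)) := mul_le_mul_of_nonneg_left h2 hc0
      _ = _ := by ring
  refine (norm_integral_le_of_norm_le (((hY u).add (hY v)).const_mul (1 / 2)).integrable
    (Eventually.of_forall hb)).trans ?_
  rw [integral_const_mul, integral_add (hY u).integrable (hY v).integrable]
  linarith [hquad u hu, hquad v hv]

/-- The constant controlling the weight of the deviation of `rowForm` in the main estimate. -/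
noncomputable def crossConst (γ a : ℝ) (K : ℝ≥0) : ℝ :=
  √√(1 / γ ^ 2 * (8 * (1 / γ ^ 2 + a ^ 2 * (concConst 4 * (K * (1 / γ)) ^ 4))))

/-- Two applications of the Cauchy-Schwarz inequality: `I` stands for `E[U V X]`, `y` for `E[U²]`,
`J` for `E[V² X²]`, `z` for `E[V⁴]` and `D` for `E[X⁴]`. -/
theorem abs_mul_le_of_cauchySchwarz {γ κ y z D I J C η : ℝ} (hγ : 0 < γ) (hκ : 0 ≤ κ) (hη : 0 ≤ η)
    (hy : 0 ≤ y) (hz : 0 ≤ z) (h1 : I ^ 2 ≤ y * J) (h2 : J ^ 2 ≤ z * D)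
    (hκy : κ * y ≤ 1 / γ) (hκz : κ ^ 2 * z ≤ C) (hDη : D ≤ η ^ 4) :
    |κ * I| ≤ √√(1 / γ ^ 2 * C) * η := by
  have hJ2 : 0 ≤ κ ^ 2 * J ^ 2 := by positivity
  have hκJ : κ ^ 2 * J ^ 2 ≤ (κ ^ 2 * z) * D := by
    rw [mul_assoc]
    exact mul_le_mul_of_nonneg_left h2 (sq_nonneg κ)
  have hC : 0 ≤ C := (by positivity : 0 ≤ κ ^ 2 * z).trans hκz
  have hη4 : 0 ≤ η ^ 4 := by positivity
  refine le_of_pow_le_pow_left₀ (n := 4) (by norm_num) (by positivity) ?_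
  have hcr : √√(1 / γ ^ 2 * C) ^ 4 = 1 / γ ^ 2 * C := by
    rw [show ∀ x : ℝ, x ^ 4 = (x ^ 2) ^ 2 from fun x => by ring,
      Real.sq_sqrt (Real.sqrt_nonneg _), Real.sq_sqrt (by positivity)]
  have h3 : κ ^ 2 * J ^ 2 ≤ C * η ^ 4 := calc
    _ ≤ κ ^ 2 * z * η ^ 4 := hκJ.trans (mul_le_mul_of_nonneg_left hDη (by positivity))
    _ ≤ _ := mul_le_mul_of_nonneg_right hκz hη4
  rw [Even.pow_abs (by decide), mul_pow, mul_pow, hcr]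
  calc κ ^ 4 * I ^ 4 = κ ^ 4 * (I ^ 2) ^ 2 := by ring
    _ ≤ κ ^ 4 * (y * J) ^ 2 := by gcongr
    _ = (κ * y) ^ 2 * (κ ^ 2 * J ^ 2) := by ring
    _ ≤ (1 / γ) ^ 2 * (C * η ^ 4) := by gcongr
    _ = _ := by ring

/-- The fourth moment of `sᵀ w` for `w = Q̄ v`, weighted with `κ² = ((n/T) / (1 + α))²`. The squared
mean is at most `wᵀ Φ w`, and `κ wᵀ Φ w ≤ 1/γ`. The fluctuation is controlled by concentration. -/
theorem kappa_sq_mul_integral_pow_four_le (hγ : 0 < γ) (hs : LipschitzWith K s) {α a : ℝ}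
    (hα : 0 ≤ α) (ha : (n : ℝ) / T ≤ a) {v : Fin T → ℝ} (hv : l2 v = 1) :
    ((n : ℝ) / T / (1 + α)) ^ 2 * ∫ x, ((s x).ofLp ⬝ᵥ
      RandomFeatures.Qbar n γ (secondMoment s) α *ᵥ v) ^ 4 ∂(stdGaussian E) ≤
      8 * (1 / γ ^ 2 + a ^ 2 * (concConst 4 * (K * (1 / γ)) ^ 4)) := by
  set κ := (n : ℝ) / T / (1 + α) with hκ
  have hκ0 : 0 ≤ κ := by positivity
  have hκa : κ ≤ a := (div_le_self (by positivity) (by linarith)).trans ha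
  have hF := posSemidef_secondMoment hs
  have hG := posSemidef_smul_of_nonneg (n := n) hF hα
  set w := RandomFeatures.Qbar n γ (secondMoment s) α *ᵥ v with hw
  have hb := allMoments_dotProduct hs w
  set m := ∫ x, (s x).ofLp ⬝ᵥ w ∂(stdGaussian E) with hm
  have hm2 : κ * m ^ 2 ≤ 1 / γ := by
    have h1 : m ^ 2 ≤ w ⬝ᵥ secondMoment s *ᵥ w := by
      rw [dotProduct_secondMoment hs]
      refine (hb.pow_integral_le even_two).trans (le_of_eq ?_)
      simp_rw [sq]
    have h2 := quadratic_reg_le hγ hG v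
    rw [← Qbar_eq_reg, ← hw, Matrix.smul_mulVec, dotProduct_smul, smul_eq_mul, hv] at h2
    calc κ * m ^ 2 ≤ κ * (w ⬝ᵥ secondMoment s *ᵥ w) := by gcongr
      _ ≤ _ := by simpa using h2
  have hc : ∫ x, ((s x).ofLp ⬝ᵥ w - m) ^ 4 ∂(stdGaussian E) ≤
      concConst 4 * (K * (1 / γ)) ^ 4 := by
    refine (integral_sub_mean_pow_le (lipschitzWith_dotProduct hs w)
      (by decide : Even 4)).trans ?_
    rw [NNReal.coe_mul, Real.coe_toNNReal _ (l2_nonneg w)]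
    have h3 : l2 w ≤ 1 / γ := by
      have := l2_reg_le hγ hG v
      rwa [hv, mul_one] at this
    have := concConst_nonneg 4
    have := l2_nonneg w
    gcongr
  have hi := (hb.sub (.const m)).pow 4
  have h4 : ∫ x, ((s x).ofLp ⬝ᵥ w) ^ 4 ∂(stdGaussian E) ≤
      8 * (m ^ 4 + concConst 4 * (K * (1 / γ)) ^ 4) := by
    calc _ ≤ ∫ x, 8 * (m ^ 4 + ((s x).ofLp ⬝ᵥ w - m) ^ 4) ∂(stdGaussian E) := by
          refine integral_mono (hb.pow 4).integrable
            (((AllMoments.const (m ^ 4)).add hi).const_mul 8).integrable fun x => ?_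
          simp only
          refine le_trans (le_of_eq ?_) (add_pow_four_le _ _)
          ring
      _ = 8 * (m ^ 4 + ∫ x, ((s x).ofLp ⬝ᵥ w - m) ^ 4 ∂(stdGaussian E)) := by
          rw [integral_const_mul, integral_add (integrable_const _) hi.integrable]
          simp
      _ ≤ _ := by gcongr
  have hC := concConst_nonneg 4
  calc _ ≤ κ ^ 2 * (8 * (m ^ 4 + concConst 4 * (K * (1 / γ)) ^ 4)) := by gcongr
    _ = 8 * ((κ * m ^ 2) ^ 2 + κ ^ 2 * (concConst 4 * (K * (1 / γ)) ^ 4)) := by ring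
    _ ≤ 8 * ((1 / γ) ^ 2 + a ^ 2 * (concConst 4 * (K * (1 / γ)) ^ 4)) := by gcongr
    _ = _ := by rw [div_pow, one_pow]

/-- The expected resolvent is close to the deterministic equivalent whose parameter is the mean
of the quadratic form of a row. -/
theorem norm_expectation_fullRes_sub_Qbar_le (hγ : 0 < γ) (hT : 0 < T) (hs : LipschitzWith K s)
    (i : Fin n) {α η a : ℝ} (hα : 0 ≤ α) (hη : 0 ≤ η) (ha : (n : ℝ) / T ≤ a)
    (hdev : ∫ W, (rowForm γ (featRows s W) i - α) ^ 4
      ∂(Measure.pi fun _ : Fin n => stdGaussian E) ≤ η ^ 4) :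
    ‖RandomFeatures.expectation (Measure.pi fun _ : Fin n => stdGaussian E) (fullRes γ s) -
      RandomFeatures.Qbar n γ (secondMoment s) α‖ ≤
      ((1 + α) / (n * γ) + η / γ) + crossConst γ a K * η := by
  have hT' : (0 : ℝ) < T := by exact_mod_cast hT
  have hn' : (0 : ℝ) < n := by exact_mod_cast i.pos
  set μ := Measure.pi fun _ : Fin n => stdGaussian E with hμ
  have hF := posSemidef_secondMoment hs
  have hG := posSemidef_smul_of_nonneg (n := n) hF hα
  have hloo := norm_expectation_looRes_sub_fullRes_le hγ hT hs i hα hη hdev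
  set EQ := RandomFeatures.expectation μ (fullRes γ s) with hEQ
  set EL := RandomFeatures.expectation μ (looRes γ s i) with hEL
  set κ := (n : ℝ) / T / (1 + α) with hκ
  have hκ0 : 0 ≤ κ := by positivity
  have hcc : 0 ≤ crossConst γ a K := Real.sqrt_nonneg _
  refine norm_le_of_unit_bilin (by positivity) fun u v hu hv => ?_
  set w := RandomFeatures.Qbar n γ (secondMoment s) α *ᵥ v with hw
  set Y : (Fin n → E) → ℝ := fun W => u ⬝ᵥ fullRes γ s W *ᵥ featRows s W i with hYdef
  set Z : (Fin n → E) → ℝ := fun W => featRows s W i ⬝ᵥ w with hZdef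
  set d : (Fin n → E) → ℝ := fun W => rowForm γ (featRows s W) i with hddef
  have hY : AllMoments Y μ := allMoments_fullRes_row hγ hT hs u i
  have hZ : AllMoments Z μ := allMoments_row_dotProduct hs w i
  have hd : AllMoments d μ := allMoments_rowForm hγ hT hs i
  have hQ := fun a b => (allMoments_fullRes (n := n) hγ hT hs a b).integrable
  -- the resolvent identity, integrated, with all rows replaced by the `i`-th
  have h1 : u ⬝ᵥ (EQ - RandomFeatures.Qbar n γ (secondMoment s) α) *ᵥ v =
      κ * (u ⬝ᵥ EQ *ᵥ secondMoment s *ᵥ w) - n / T * ∫ W, Y W * Z W ∂μ := by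
    have hpt : ∀ W : Fin n → E, u ⬝ᵥ fullRes γ s W *ᵥ v -
        u ⬝ᵥ RandomFeatures.Qbar n γ (secondMoment s) α *ᵥ v =
        κ * (u ⬝ᵥ fullRes γ s W *ᵥ secondMoment s *ᵥ w) -
        1 / T * ∑ j, (u ⬝ᵥ fullRes γ s W *ᵥ featRows s W j) * (featRows s W j ⬝ᵥ w) := by
      intro W
      have h2 := reg_sub_reg hγ (posSemidef_gram (featRows s W)) hG
      have h3 := congrArg (fun M => u ⬝ᵥ M *ᵥ v) h2
      simp only [Matrix.sub_mulVec, dotProduct_sub, ← Matrix.mulVec_mulVec, Matrix.mulVec_sub] at h3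
      rw [← Qbar_eq_reg, ← hw, Matrix.smul_mulVec, Matrix.mulVec_smul, dotProduct_smul,
        smul_eq_mul, ← mulVec_dotProduct_comm (transpose_reg (posSemidef_gram _)) u
        (gram _ *ᵥ w), dotProduct_gram] at h3
      rw [fullRes, h3]
      congr 2
      rw [dotProduct]
      refine Finset.sum_congr rfl fun j _ => ?_
      congr 1
      rw [← mulVec_dotProduct_comm (transpose_reg (posSemidef_gram _)), dotProduct_comm]
      rfl
    have hYZ : ∀ j, AllMoments (fun W : Fin n → E =>
        (u ⬝ᵥ fullRes γ s W *ᵥ featRows s W j) * (featRows s W j ⬝ᵥ w)) μ := fun j =>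
      (allMoments_fullRes_row hγ hT hs u j).mul (allMoments_row_dotProduct hs w j)
    have hbil : ∀ z : Fin T → ℝ, AllMoments (fun W : Fin n → E => u ⬝ᵥ fullRes γ s W *ᵥ z) μ :=
      fun z => AllMoments.dotProduct (u := fun _ => u) (fun _ => .const _)
        (AllMoments.mulVec (v := fun _ => z) (allMoments_fullRes hγ hT hs) (fun _ => .const _))
    have h4 := integral_congr_ae (μ := μ) (Eventually.of_forall hpt)
    rw [integral_sub (hbil v).integrable (integrable_const _),
      integral_sub ((hbil _).const_mul κ).integrable
        ((AllMoments.sum _ fun j _ => hYZ j).const_mul _).integrable,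
      integral_const_mul, integral_const_mul, integral_finsetSum _ fun j _ => (hYZ j).integrable,
      integral_dotProduct_mulVec hQ, integral_dotProduct_mulVec hQ,
      Finset.sum_congr rfl fun j _ => integral_row_eq (s := s) (γ := γ) i j
        fun x Q => (u ⬝ᵥ Q *ᵥ x) * (x ⬝ᵥ w)] at h4
    rw [Finset.sum_const, Finset.card_univ, Fintype.card_fin, nsmul_eq_mul, integral_const,
      probReal_univ, one_smul, ← hEQ] at h4
    rw [Matrix.sub_mulVec, dotProduct_sub, h4]
    ring
  -- integrating the `i`-th row out first, given the others
  have h2 : ∫ W, (1 + d W) * (Y W * Z W) ∂μ = u ⬝ᵥ EL *ᵥ secondMoment s *ᵥ w := by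
    have hint : AllMoments (fun W => (1 + d W) * (Y W * Z W)) μ :=
      ((AllMoments.const 1).add hd).mul (hY.mul hZ)
    rw [integral_update i hint.integrable,
      ← integral_dotProduct_mulVec fun a b => (allMoments_looRes hγ hT hs i a b).integrable]
    refine integral_congr_ae (Eventually.of_forall fun W => ?_)
    simp only
    have hsymm : (looRes γ s i W)ᵀ = looRes γ s i W := transpose_reg (posSemidef_gram _)
    rw [← mulVec_dotProduct_comm hsymm, dotProduct_secondMoment hs]
    refine integral_congr_ae (Eventually.of_forall fun x => ?_)
    have h3 := reg_updateRow_mulVec_row hγ (featRows s (Function.update W i x)) i u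
    have h5 : reg γ (gram ((featRows s (Function.update W i x)).updateRow i 0)) =
      looRes γ s i W := looRes_update i W x
    rw [h5] at h3
    simp only [hYdef, hZdef, hddef, fullRes]
    rw [← mul_assoc, ← h3, featRows_apply, Function.update_self,
      ← mulVec_dotProduct_comm hsymm, dotProduct_comm (_ *ᵥ u)]
  have h3 : u ⬝ᵥ (EQ - RandomFeatures.Qbar n γ (secondMoment s) α) *ᵥ v =
      κ * (u ⬝ᵥ (EQ - EL) *ᵥ secondMoment s *ᵥ w) +
        κ * ∫ W, Y W * (Z W * (d W - α)) ∂μ := by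
    have h4 : ∫ W, Y W * (Z W * (d W - α)) ∂μ =
        (∫ W, (1 + d W) * (Y W * Z W) ∂μ) - (1 + α) * ∫ W, Y W * Z W ∂μ := by
      rw [← integral_const_mul, ← integral_sub
        (((AllMoments.const 1).add hd).mul (hY.mul hZ)).integrable
        ((hY.mul hZ).const_mul _).integrable]
      exact integral_congr_ae (Eventually.of_forall fun W => by simp only; ring)
    have h5 : (n : ℝ) / T = κ * (1 + α) := by
      rw [hκ]
      field_simp
    rw [h1, h4, h2, h5, Matrix.sub_mulVec, dotProduct_sub]
    ring
  have h4 : |κ * (u ⬝ᵥ (EQ - EL) *ᵥ secondMoment s *ᵥ w)| ≤ (1 + α) / (n * γ) + η / γ := by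
    have h5 : κ * (u ⬝ᵥ (EQ - EL) *ᵥ secondMoment s *ᵥ w) =
        u ⬝ᵥ ((EQ - EL) * (κ • (secondMoment s *
          RandomFeatures.Qbar n γ (secondMoment s) α))) *ᵥ v := by
      rw [← Matrix.mulVec_mulVec, Matrix.smul_mulVec, ← Matrix.mulVec_mulVec, Matrix.mulVec_smul,
        dotProduct_smul, smul_eq_mul]
    rw [h5]
    refine (abs_dotProduct_mulVec_le _ u v).trans ?_
    rw [hu, hv, mul_one, mul_one]
    refine (Matrix.l2_opNorm_mul _ _).trans ?_
    refine (mul_le_of_le_one_right (norm_nonneg _) (norm_smul_mul_Qbar_le hγ hF hα)).trans ?_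
    rw [norm_sub_rev]
    exact hloo
  have h5 : |κ * ∫ W, Y W * (Z W * (d W - α)) ∂μ| ≤ crossConst γ a K * η := by
    have hda := hd.sub (AllMoments.const α)
    have hY2 : ∫ W, Y W ^ 2 ∂μ ≤ T / (n * γ) := integral_sq_fullRes_row_le hγ hT hs hu i
    have hZ4 : κ ^ 2 * ∫ W, Z W ^ 4 ∂μ ≤
        8 * (1 / γ ^ 2 + a ^ 2 * (concConst 4 * (K * (1 / γ)) ^ 4)) := by
      have h6 := kappa_sq_mul_integral_pow_four_le (n := n) hγ hs hα ha hv
      have h7 := (measurePreserving_eval (fun _ : Fin n => stdGaussian E) i)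
      rw [← h7.map_eq, integral_map h7.aemeasurable
        (by rw [h7.map_eq]; exact ((allMoments_dotProduct hs _).pow 4).integrable.1)] at h6
      exact h6
    have hCS1 := hY.sq_integral_mul_le (hZ.mul hda)
    have hCS2 := (hZ.pow 2).sq_integral_mul_le (hda.pow 2)
    have e1 : ∫ W, (Z W * (d W - α)) ^ 2 ∂μ = ∫ W, Z W ^ 2 * (d W - α) ^ 2 ∂μ := by
      simp_rw [mul_pow]
    simp_rw [← pow_mul] at hCS2
    rw [e1] at hCS1
    set I := ∫ W, Y W * (Z W * (d W - α)) ∂μ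
    set J := ∫ W, Z W ^ 2 * (d W - α) ^ 2 ∂μ
    have hY0 : 0 ≤ ∫ W, Y W ^ 2 ∂μ := integral_nonneg fun W => by positivity
    have hκY : κ * ∫ W, Y W ^ 2 ∂μ ≤ 1 / γ := by
      calc _ ≤ (n : ℝ) / T * (T / (n * γ)) :=
            mul_le_mul (div_le_self (by positivity) (by linarith)) hY2 hY0 (by positivity)
        _ = _ := by field_simp
    exact abs_mul_le_of_cauchySchwarz hγ hκ0 hη hY0
      (integral_nonneg fun W => Even.pow_nonneg (by decide) _)
      hCS1 hCS2 hκY hZ4 hdev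
  rw [h3]
  exact (abs_add_le _ _).trans (add_le_add h4 h5)

end ExpectedResolvent

/-! ### The deterministic equivalent at the fixed point -/

section CoreEstimate

variable {E : Type*} [NormedAddCommGroup E] [InnerProductSpace ℝ E] [FiniteDimensional ℝ E]
  [MeasurableSpace E] [BorelSpace E] {n T : ℕ} {s : E → EuclideanSpace ℝ (Fin T)} {K : ℝ≥0}
  {γ B : ℝ}

theorem meanRowForm_eq_meanForm_expectation (hγ : 0 < γ) (hT : 0 < T) (hs : LipschitzWith K s)
    (i : Fin n) :
    meanRowForm γ s i = meanForm s
      (RandomFeatures.expectation (Measure.pi fun _ : Fin n => stdGaussian E) (looRes γ s i)) := by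
  have hint : ∀ a b, Integrable (fun W => secondMoment s a b * looRes γ s i W b a)
      (Measure.pi fun _ : Fin n => stdGaussian E) := fun a b =>
    (allMoments_looRes hγ hT hs i b a).integrable.const_mul _
  simp only [meanRowForm, meanForm, Matrix.trace, Matrix.diag_apply, Matrix.mul_apply]
  rw [integral_const_mul, integral_finsetSum _ fun a _ => integrable_finsetSum _ fun b _ =>
    hint a b]
  congr 1
  refine Finset.sum_congr rfl fun a _ => ?_
  rw [integral_finsetSum _ fun b _ => hint a b]
  exact Finset.sum_congr rfl fun b _ => integral_const_mul _ _

/-- The scale of the deviation of `rowForm` from its mean, times `√n`. -/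
noncomputable def devScale (γ B a : ℝ) (K : ℝ≥0) : ℝ := √√(devConst γ B K) * √a

/-- The bound for the effect of removing one row, times `√n`. -/
noncomputable def looScale (γ B a : ℝ) (K : ℝ≥0) : ℝ :=
  (1 + B / γ) / γ + devScale γ B a K / γ

/-- The constant of the deterministic equivalent. -/
noncomputable def coreConst (γ B a : ℝ) (K : ℝ≥0) : ℝ :=
  (looScale γ B a K + crossConst γ a K * devScale γ B a K) +
    1 / γ * (B * (2 * looScale γ B a K + crossConst γ a K * devScale γ B a K))

theorem devConst_nonneg (hγ : 0 < γ) : 0 ≤ devConst γ B K := by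
  have h4 := concConst_nonneg 4
  have h8 := concConst_nonneg 8
  have h : 0 ≤ (B * (2 / (γ * √γ)) * K) ^ 4 := Even.pow_nonneg (by decide) _
  unfold devConst quadConst
  positivity

/-- The deterministic equivalent, with explicit dependence on the dimensions, for rows that are
Lipschitz images of independent standard Gaussian vectors. -/
theorem norm_expectation_fullRes_sub_Qbar_fixedPoint_le (hγ : 0 < γ) (hT : 0 < T)
    (hn : 0 < n) (hs : LipschitzWith K s) (hB : 1 / (T : ℝ) * (secondMoment s).trace ≤ B) {a : ℝ}
    (ha : (n : ℝ) / T ≤ a) {δ : ℝ} (hδ : 0 ≤ δ)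
    (hfix : RandomFeatures.FixedPoint n γ (secondMoment s) δ) :
    ‖RandomFeatures.expectation (Measure.pi fun _ : Fin n => stdGaussian E) (fullRes γ s) -
      RandomFeatures.Qbar n γ (secondMoment s) δ‖ ≤ coreConst γ B a K / √n := by
  have hT' : (0 : ℝ) < T := by exact_mod_cast hT
  have hn' : (0 : ℝ) < n := by exact_mod_cast hn
  have hn1 : (1 : ℝ) ≤ n := by exact_mod_cast hn
  have hsn : 0 < √(n : ℝ) := Real.sqrt_pos.2 hn'
  have hF := posSemidef_secondMoment hs
  have hB0 : 0 ≤ B := le_trans (mul_nonneg (by positivity) hF.trace_nonneg) hB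
  have ha0 : 0 ≤ a := le_trans (by positivity) ha
  let i : Fin n := ⟨0, hn⟩
  set α := meanRowForm γ s i with hα
  have hα0 : 0 ≤ α := meanRowForm_nonneg hγ hs i
  have hdev0 := devConst_nonneg (B := B) (K := K) hγ
  set h := devScale γ B a K with hh
  have hh0 : 0 ≤ h := mul_nonneg (Real.sqrt_nonneg _) (Real.sqrt_nonneg _)
  set η := h / √n with hη
  have hη0 : 0 ≤ η := by positivity
  have hdev : ∫ W, (rowForm γ (featRows s W) i - α) ^ 4
      ∂(Measure.pi fun _ : Fin n => stdGaussian E) ≤ η ^ 4 := by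
    refine (integral_rowForm_sub_pow_four_le hγ hT hs hB0 hB i).trans ?_
    have h1 : η ^ 4 = devConst γ B K * (a / n) ^ 2 := by
      have e : ∀ x : ℝ, x ^ 4 = (x ^ 2) ^ 2 := fun x => by ring
      rw [hη, hh, devScale, e, div_pow, mul_pow, Real.sq_sqrt (Real.sqrt_nonneg _),
        Real.sq_sqrt ha0, Real.sq_sqrt hn'.le, div_pow, mul_pow, Real.sq_sqrt hdev0]
      ring
    have h2 : 1 / (T : ℝ) ≤ a / n := by
      rw [le_div_iff₀ hn']
      exact le_trans (le_of_eq (by ring)) ha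
    rw [h1, div_eq_mul_one_div, ← one_div_pow]
    gcongr
  have hloo := norm_expectation_looRes_sub_fullRes_le hγ hT hs i hα0 hη0 hdev
  have hmain := norm_expectation_fullRes_sub_Qbar_le hγ hT hs i hα0 hη0 ha hdev
  set EQ := RandomFeatures.expectation (Measure.pi fun _ : Fin n => stdGaussian E)
    (fullRes γ s) with hEQ
  set EL := RandomFeatures.expectation (Measure.pi fun _ : Fin n => stdGaussian E)
    (looRes γ s i) with hEL
  set Qα := RandomFeatures.Qbar n γ (secondMoment s) α with hQα
  have hαB : α ≤ B / γ := by
    rw [hα, meanRowForm_eq_meanForm_expectation hγ hT hs i, div_eq_mul_one_div]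
    refine (le_abs_self _).trans ((abs_meanForm_le hs hB _).trans ?_)
    refine mul_le_mul_of_nonneg_left ?_ hB0
    exact norm_expectation_le (fun a b => (allMoments_looRes hγ hT hs i a b).integrable)
      (by positivity) (norm_looRes_le hγ i)
  -- the error caused by removing one row
  have he : (1 + α) / (n * γ) + η / γ ≤ looScale γ B a K / √n := by
    have h1 : √(n : ℝ) ≤ n := by
      rw [Real.sqrt_le_left hn'.le]
      nlinarith
    have h2 : (1 + α) / (n * γ) ≤ (1 + B / γ) / (√n * γ) := by gcongr
    refine (add_le_add_left h2 _).trans (le_of_eq ?_)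
    rw [looScale, hη, ← hh]
    field_simp
  set e := looScale γ B a K with hedef
  set c := crossConst γ a K with hc
  have hcη : c * η = c * h / √n := by rw [hη]; ring
  have h1 : ‖EL - EQ‖ ≤ e / √n := hloo.trans he
  have h2 : ‖EQ - Qα‖ ≤ e / √n + c * h / √n := by
    rw [← hcη]
    exact hmain.trans (by gcongr)
  have h3 : |α - traceMap n γ (secondMoment s) α| ≤ B * (2 * (e / √n) + c * h / √n) := by
    have h4 : α - traceMap n γ (secondMoment s) α = meanForm s (EL - Qα) := by
      rw [meanForm_sub, hEL, ← meanRowForm_eq_meanForm_expectation hγ hT hs i]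
      rfl
    rw [h4]
    refine (abs_meanForm_le hs hB _).trans (mul_le_mul_of_nonneg_left ?_ hB0)
    calc ‖EL - Qα‖ = ‖(EL - EQ) + (EQ - Qα)‖ := by rw [sub_add_sub_cancel]
      _ ≤ e / √n + (e / √n + c * h / √n) := (norm_add_le _ _).trans (add_le_add h1 h2)
      _ = _ := by ring
  calc _ = ‖(EQ - Qα) + (Qα - RandomFeatures.Qbar n γ (secondMoment s) δ)‖ := by
        rw [sub_add_sub_cancel]
    _ ≤ (e / √n + c * h / √n) + 1 / γ * (B * (2 * (e / √n) + c * h / √n)) := by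
        refine (norm_add_le _ _).trans (add_le_add h2 ?_)
        refine (norm_Qbar_sub_Qbar_le hγ hF hα0 hδ hfix).trans ?_
        gcongr
    _ = _ := by
        rw [coreConst, ← hedef, ← hc, ← hh]
        ring

end CoreEstimate

/-! ### Random features of Gaussian weights -/

section Features

variable {n p T : ℕ} {σ φ : ℝ → ℝ} {lσ lφ : ℝ≥0} {X : Matrix (Fin p) (Fin T) ℝ}

/-- The random feature map between Euclidean spaces. -/
noncomputable def featureMap (σ φ : ℝ → ℝ) (X : Matrix (Fin p) (Fin T) ℝ)
    (x : EuclideanSpace ℝ (Fin p)) : EuclideanSpace ℝ (Fin T) :=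
  WithLp.toLp 2 (RandomFeatures.featureVec σ φ X x.ofLp)

theorem l2_vecMul_le (X : Matrix (Fin p) (Fin T) ℝ) (u : Fin p → ℝ) :
    l2 (u ᵥ* X) ≤ ‖X‖ * l2 u := by
  rw [← Matrix.mulVec_transpose]
  refine (l2_mulVec_le _ _).trans (le_of_eq ?_)
  rw [← Matrix.conjTranspose_eq_transpose_of_trivial, Matrix.l2_opNorm_conjTranspose]

theorem l2_le_of_abs_le {ι : Type*} [Fintype ι] {u v : ι → ℝ} {c : ℝ} (hc : 0 ≤ c)
    (h : ∀ a, |u a| ≤ c * |v a|) : l2 u ≤ c * l2 v := by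
  refine abs_le_of_sq_le_sq' ?_ (mul_nonneg hc (l2_nonneg v)) |>.2
  rw [mul_pow, l2_sq, l2_sq, dotProduct, dotProduct, Finset.mul_sum]
  refine Finset.sum_le_sum fun a _ => ?_
  calc u a * u a = |u a| ^ 2 := by rw [sq_abs, sq]
    _ ≤ (c * |v a|) ^ 2 := pow_le_pow_left₀ (abs_nonneg _) (h a) 2
    _ = _ := by rw [mul_pow, sq_abs, sq (v a)]

theorem lipschitzWith_featureMap (hσ : LipschitzWith lσ σ) (hφ : LipschitzWith lφ φ) {C : ℝ≥0}
    (hX : ‖X‖ ≤ C) : LipschitzWith (lσ * C * lφ) (featureMap σ φ X) := by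
  refine LipschitzWith.of_dist_le_mul fun x y => ?_
  have h1 : dist (featureMap σ φ X x) (featureMap σ φ X y) =
      l2 (RandomFeatures.featureVec σ φ X x.ofLp - RandomFeatures.featureVec σ φ X y.ofLp) := by
    rw [dist_eq_norm]
    rfl
  have h2 : dist x y = l2 (x.ofLp - y.ofLp) := by
    rw [dist_eq_norm]
    rfl
  rw [h1, h2]
  set u : Fin p → ℝ := (fun i => φ (x.ofLp i)) - fun i => φ (y.ofLp i) with hu
  have h3 : l2 u ≤ lφ * l2 (x.ofLp - y.ofLp) :=
    l2_le_of_abs_le lφ.coe_nonneg fun i => by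
      simpa [hu, Real.dist_eq] using hφ.dist_le_mul (x.ofLp i) (y.ofLp i)
  have h4 : l2 (RandomFeatures.featureVec σ φ X x.ofLp - RandomFeatures.featureVec σ φ X y.ofLp) ≤
      lσ * l2 (u ᵥ* X) := by
    refine l2_le_of_abs_le lσ.coe_nonneg fun a => ?_
    rw [hu, Matrix.sub_vecMul]
    simpa [Real.dist_eq, RandomFeatures.featureVec] using hσ.dist_le_mul
      (((fun i => φ (x.ofLp i)) ᵥ* X) a) (((fun i => φ (y.ofLp i)) ᵥ* X) a)
  have h5 := l2_vecMul_le X u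
  have h6 := l2_nonneg u
  push_cast
  calc _ ≤ lσ * (C * (lφ * l2 (x.ofLp - y.ofLp))) := by
        refine h4.trans ?_
        gcongr
        exact h5.trans (by gcongr)
    _ = _ := by ring

theorem secondMoment_featureMap (σ φ : ℝ → ℝ) (X : Matrix (Fin p) (Fin T) ℝ) :
    secondMoment (featureMap σ φ X) = RandomFeatures.Phi σ φ X := by
  have hemb : MeasurableEmbedding (WithLp.toLp 2 : (Fin p → ℝ) → EuclideanSpace ℝ (Fin p)) :=
    (MeasurableEquiv.toLp 2 (Fin p → ℝ)).measurableEmbedding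
  ext a b
  simp only [secondMoment, RandomFeatures.Phi, RandomFeatures.expectation, Matrix.of_apply]
  rw [← map_pi_eq_stdGaussian, hemb.integral_map]
  rfl

theorem integral_norm_sq_stdGaussian :
    ∫ x : EuclideanSpace ℝ (Fin p), ‖x‖ ^ 2 ∂(stdGaussian (EuclideanSpace ℝ (Fin p))) = p := by
  have hemb : MeasurableEmbedding (WithLp.toLp 2 : (Fin p → ℝ) → EuclideanSpace ℝ (Fin p)) :=
    (MeasurableEquiv.toLp 2 (Fin p → ℝ)).measurableEmbedding
  have h2 : Integrable (fun y : ℝ => y ^ 2) (gaussianReal 0 1) :=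
    (memLp_id_gaussianReal (μ := 0) (v := 1) 2).integrable_sq
  have h1 : ∫ y : ℝ, y ^ 2 ∂(gaussianReal 0 1) = 1 := by
    have h := variance_fun_id_gaussianReal (μ := 0) (v := 1)
    rw [variance_eq_integral (by fun_prop)] at h
    simpa using h
  rw [← map_pi_eq_stdGaussian, hemb.integral_map]
  simp_rw [EuclideanSpace.real_norm_sq_eq]
  have hev := fun j : Fin p => measurePreserving_eval (fun _ : Fin p => gaussianReal 0 1) j
  have hint : ∀ j : Fin p, Integrable (fun x : Fin p → ℝ => x j ^ 2)
      (Measure.pi fun _ => gaussianReal 0 1) := fun j =>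
    ((hev j).integrable_comp h2.aestronglyMeasurable).2 h2
  rw [integral_finsetSum _ fun j _ => hint j]
  have h3 : ∀ j : Fin p, ∫ x : Fin p → ℝ, x j ^ 2 ∂(Measure.pi fun _ => gaussianReal 0 1) = 1 := by
    intro j
    rw [← h1]
    conv_rhs => rw [← (hev j).map_eq]
    rw [integral_map (hev j).aemeasurable (by rw [(hev j).map_eq]; exact h2.1)]
  simp [h3]

/-- The trace is `E‖s‖²`, and `‖s(x)‖ ≤ ‖s(0)‖ + L ‖x‖` for the Lipschitz feature map `s`. -/
theorem trace_Phi_le (hσ : LipschitzWith lσ σ) (hφ : LipschitzWith lφ φ) {C : ℝ≥0}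
    (hX : ‖X‖ ≤ C) : (RandomFeatures.Phi σ φ X).trace ≤
      2 * (2 * σ 0 ^ 2 * T + 2 * (lσ * C) ^ 2 * (φ 0 ^ 2 * p)) + 2 * (lσ * C * lφ) ^ 2 * p := by
  have hs := lipschitzWith_featureMap hσ hφ hX
  set s := featureMap σ φ X with hsdef
  have h0 : l2 (s 0).ofLp ^ 2 ≤ 2 * σ 0 ^ 2 * T + 2 * (lσ * C) ^ 2 * (φ 0 ^ 2 * p) := by
    set z : Fin T → ℝ := (fun _ => φ 0) ᵥ* X with hz
    have h1 : l2 z ≤ C * l2 (fun _ : Fin p => φ 0) :=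
      (l2_vecMul_le X _).trans (mul_le_mul_of_nonneg_right hX (l2_nonneg _))
    have h2 : l2 (fun _ : Fin p => φ 0) ^ 2 = φ 0 ^ 2 * p := by
      rw [l2_sq]
      simp [dotProduct]
      ring
    have h3 : l2 z ^ 2 ≤ C ^ 2 * (φ 0 ^ 2 * p) := by
      rw [← h2, ← mul_pow]
      exact pow_le_pow_left₀ (l2_nonneg _) h1 2
    have h4 : l2 (s 0).ofLp ^ 2 ≤ ∑ a, (2 * σ 0 ^ 2 + 2 * lσ ^ 2 * (z a * z a)) := by
      rw [l2_sq, dotProduct]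
      refine Finset.sum_le_sum fun a _ => ?_
      have h5 : (s 0).ofLp a = σ (z a) := by
        simp [hsdef, featureMap, RandomFeatures.featureVec, hz]
      have h6 := hσ.dist_le_mul (z a) 0
      rw [Real.dist_eq, Real.dist_eq, sub_zero] at h6
      have h7 : (σ (z a) - σ 0) ^ 2 ≤ lσ ^ 2 * (z a * z a) := by
        rw [← sq_abs (σ (z a) - σ 0)]
        refine (pow_le_pow_left₀ (abs_nonneg _) h6 2).trans (le_of_eq ?_)
        rw [mul_pow, sq_abs, sq (z a)]
      rw [h5]
      nlinarith [sq_nonneg (σ (z a) - 2 * σ 0)]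
    rw [Finset.sum_add_distrib, ← Finset.mul_sum _ _ (2 * (lσ : ℝ) ^ 2), Finset.sum_const,
      Finset.card_univ, Fintype.card_fin, nsmul_eq_mul] at h4
    have h8 : ∑ a, z a * z a = l2 z ^ 2 := (l2_sq z).symm
    rw [h8] at h4
    calc _ ≤ _ := h4
      _ ≤ T * (2 * σ 0 ^ 2) + 2 * lσ ^ 2 * (C ^ 2 * (φ 0 ^ 2 * p)) := by gcongr
      _ = _ := by ring
  have htr := trace_secondMoment_mul hs 1
  rw [mul_one, secondMoment_featureMap] at htr
  have hnorm : Integrable (fun x : EuclideanSpace ℝ (Fin p) => ‖x‖ ^ 2)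
      (stdGaussian (EuclideanSpace ℝ (Fin p))) :=
    IsGaussian.memLp_two_id.norm.integrable_sq
  rw [htr]
  have hpt : ∀ x, (s x).ofLp ⬝ᵥ (1 : Matrix (Fin T) (Fin T) ℝ) *ᵥ (s x).ofLp ≤
      2 * l2 (s 0).ofLp ^ 2 + 2 * (lσ * C * lφ) ^ 2 * ‖x‖ ^ 2 := by
    intro x
    rw [Matrix.one_mulVec, ← l2_sq]
    have h1 := hs.dist_le_mul x 0
    rw [dist_eq_norm, dist_zero_right] at h1
    push_cast at h1
    have h2 : l2 (s x).ofLp ≤ l2 (s 0).ofLp + lσ * C * lφ * ‖x‖ := by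
      have h3 : ‖s x‖ ≤ ‖s 0‖ + ‖s x - s 0‖ := by
        simpa using norm_add_le (s 0) (s x - s 0)
      exact h3.trans (by gcongr; rfl)
    have h4 := pow_le_pow_left₀ (l2_nonneg _) h2 2
    nlinarith [sq_nonneg (l2 (s 0).ofLp - lσ * C * lφ * ‖x‖)]
  have hint : Integrable (fun x => (s x).ofLp ⬝ᵥ (1 : Matrix (Fin T) (Fin T) ℝ) *ᵥ (s x).ofLp)
      (stdGaussian (EuclideanSpace ℝ (Fin p))) := by
    simp only [Matrix.one_mulVec]
    exact (AllMoments.dotProduct (allMoments_coord hs) (allMoments_coord hs)).integrable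
  have hint2 : Integrable (fun x : EuclideanSpace ℝ (Fin p) =>
      2 * l2 (s 0).ofLp ^ 2 + 2 * (lσ * C * lφ) ^ 2 * ‖x‖ ^ 2)
      (stdGaussian (EuclideanSpace ℝ (Fin p))) :=
    (integrable_const _).add (hnorm.const_mul _)
  refine (integral_mono hint hint2 hpt).trans ?_
  rw [integral_add (integrable_const _) (hnorm.const_mul _), integral_const, probReal_univ,
    one_smul, integral_const_mul, integral_norm_sq_stdGaussian]
  gcongr

theorem measurePreserving_curry_gaussian :
    MeasurePreserving (fun (x : Fin n × Fin p → ℝ) (i : Fin n) (j : Fin p) => x (i, j))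
      (Measure.pi fun _ => gaussianReal 0 1)
      (Measure.pi fun _ : Fin n => Measure.pi fun _ : Fin p => gaussianReal 0 1) := by
  have h : MeasurePreserving (MeasurableEquiv.curry (Fin n) (Fin p) ℝ).symm
      (Measure.pi fun _ : Fin n => Measure.pi fun _ : Fin p => gaussianReal 0 1)
      (Measure.pi fun _ => gaussianReal 0 1) := by
    refine ⟨MeasurableEquiv.measurable _, (Measure.pi_eq fun A hA => ?_).symm⟩
    have hpre : (MeasurableEquiv.curry (Fin n) (Fin p) ℝ).symm ⁻¹' Set.univ.pi A =
        Set.univ.pi fun i => Set.univ.pi fun j => A (i, j) := by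
      ext x
      simp only [Set.mem_preimage, Set.mem_pi, Set.mem_univ, true_implies, Prod.forall]
      rfl
    rw [Measure.map_apply (MeasurableEquiv.measurable _) (MeasurableSet.univ_pi hA), hpre,
      Measure.pi_pi]
    simp_rw [Measure.pi_pi]
    rw [Fintype.prod_prod_type]
  exact h.symm

theorem measurePreserving_rows_gaussian :
    MeasurePreserving
      (fun (x : Fin n × Fin p → ℝ) (i : Fin n) =>
        (WithLp.toLp 2 fun j => x (i, j) : EuclideanSpace ℝ (Fin p)))
      (Measure.pi fun _ => gaussianReal 0 1)
      (Measure.pi fun _ : Fin n => stdGaussian (EuclideanSpace ℝ (Fin p))) := by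
  have h1 : MeasurePreserving (WithLp.toLp 2 : (Fin p → ℝ) → EuclideanSpace ℝ (Fin p))
      (Measure.pi fun _ => gaussianReal 0 1) (stdGaussian (EuclideanSpace ℝ (Fin p))) :=
    ⟨by fun_prop, map_pi_eq_stdGaussian⟩
  exact (measurePreserving_pi (fun _ : Fin n => Measure.pi fun _ : Fin p => gaussianReal 0 1)
    (fun _ : Fin n => stdGaussian (EuclideanSpace ℝ (Fin p))) fun _ => h1).comp
      measurePreserving_curry_gaussian

/-- The expected resolvent depends only on the law of the weights, so the rows may be taken to be
independent standard Gaussian vectors on a product space. -/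
theorem expectation_resolvent_eq {Ω : Type*} [MeasurableSpace Ω] {P : Measure Ω}
    [IsProbabilityMeasure P] {V : Ω → Matrix (Fin n) (Fin p) ℝ}
    (hV : RandomFeatures.IsGaussianMatrix V P) {γ : ℝ} (hγ : 0 < γ) (hT : 0 < T)
    (hσ : LipschitzWith lσ σ) (hφ : LipschitzWith lφ φ) :
    RandomFeatures.expectation P (fun ω => RandomFeatures.resolvent γ
        (RandomFeatures.featureMatrix σ ((V ω).map φ) X)) =
      RandomFeatures.expectation
        (Measure.pi fun _ : Fin n => stdGaussian (EuclideanSpace ℝ (Fin p)))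
        (fullRes γ (featureMap σ φ X)) := by
  have hs := lipschitzWith_featureMap (X := X) (C := ‖X‖₊) hσ hφ le_rfl
  have hae : ∀ ij : Fin n × Fin p, AEMeasurable (fun ω => V ω ij.1 ij.2) P :=
    fun ij => (hV.hasLaw ij.1 ij.2).aemeasurable
  have hmap : P.map (fun ω (ij : Fin n × Fin p) => V ω ij.1 ij.2) =
      Measure.pi fun _ => gaussianReal 0 1 := by
    rw [(iIndepFun_iff_map_fun_eq_pi_map hae).1 hV.indep]
    congr 1
    funext ij
    exact (hV.hasLaw ij.1 ij.2).map_eq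
  have haem : AEMeasurable (fun ω (ij : Fin n × Fin p) => V ω ij.1 ij.2) P :=
    aemeasurable_pi_lambda _ hae
  have hmp := measurePreserving_rows_gaussian (n := n) (p := p)
  ext a b
  simp only [RandomFeatures.expectation, Matrix.of_apply]
  have hint := (allMoments_fullRes (n := n) hγ hT hs a b).integrable
  have hint' := (hmp.integrable_comp hint.aestronglyMeasurable).2 hint
  rw [← hmp.map_eq, integral_map hmp.aemeasurable (by rw [hmp.map_eq]; exact hint.1), ← hmap,
    integral_map haem (by rw [hmap]; exact hint'.1)]
  rfl

end Features

/-! ### The proportional growth regime -/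

theorem posSemidef_Phi {p T : ℕ} {σ φ : ℝ → ℝ} {lσ lφ : ℝ≥0} (hσ : LipschitzWith lσ σ)
    (hφ : LipschitzWith lφ φ) (X : Matrix (Fin p) (Fin T) ℝ) :
    (RandomFeatures.Phi σ φ X).PosSemidef := by
  rw [← secondMoment_featureMap]
  exact posSemidef_secondMoment (lipschitzWith_featureMap (C := ‖X‖₊) hσ hφ le_rfl)

/-- The growth assumption gives bounds that hold for all large `n`. -/
theorem RandomFeatures.GrowthRate.exists_bounds {p T : ℕ → ℕ}
    {X : ∀ n, Matrix (Fin (p n)) (Fin (T n)) ℝ} (h : RandomFeatures.GrowthRate p T X) :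
    ∃ a b : ℝ, ∃ C : ℝ≥0, ∀ᶠ n in atTop, 0 < n ∧ 0 < T n ∧ (n : ℝ) / T n ≤ a ∧
      (p n : ℝ) / T n ≤ b ∧ ‖X n‖ ≤ C := by
  obtain ⟨r, hr0, hr⟩ := EReal.lt_iff_exists_real_btwn.1 h.liminf_pos
  obtain ⟨R, hR, -⟩ := EReal.lt_iff_exists_real_btwn.1 h.limsup_lt_top
  obtain ⟨C, hC, -⟩ := EReal.lt_iff_exists_real_btwn.1 h.limsup_norm_lt_top
  have hr0' : 0 < r := by exact_mod_cast hr0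
  refine ⟨1 / r, |R| / r, C.toNNReal, ?_⟩
  filter_upwards [eventually_lt_of_lt_liminf hr, eventually_lt_of_limsup_lt hR,
    eventually_lt_of_limsup_lt hC, eventually_gt_atTop 0] with n h1 h2 h3 hn
  have h1' := EReal.coe_lt_coe_iff.1 h1
  have h2' := EReal.coe_lt_coe_iff.1 h2
  have h3' := EReal.coe_lt_coe_iff.1 h3
  have hn' : (0 : ℝ) < n := by exact_mod_cast hn
  have hTn : r * n < T n := (lt_div_iff₀ hn').1 (h1'.trans_le (min_le_right _ _))
  have hpn : (p n : ℝ) < R * n := (div_lt_iff₀ hn').1 ((le_max_left _ _).trans_lt h2')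
  have hT' : (0 : ℝ) < T n := lt_trans (by positivity) hTn
  refine ⟨hn, by exact_mod_cast hT', ?_, ?_, h3'.le.trans (Real.le_coe_toNNReal C)⟩
  · rw [div_le_div_iff₀ hT' hr0']
    linarith
  · rw [div_le_div_iff₀ hT' hr0']
    calc (p n : ℝ) * r ≤ |R| * n * r := by
          gcongr
          exact hpn.le.trans (mul_le_mul_of_nonneg_right (le_abs_self R) hn'.le)
      _ = |R| * (r * n) := by ring
      _ ≤ |R| * T n := by gcongr

/-- An eventual bound by a multiple of a positive sequence holds from the start, after enlarging
the constant, if each of the finitely many remaining quantities is bounded. -/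
theorem exists_bound_of_eventually {ι : ℕ → Type*} {f : ∀ n, ι n → ℝ} {g : ℕ → ℝ} {C : ℝ}
    (hg : ∀ n, 1 ≤ n → 0 < g n) (hbdd : ∀ n, ∃ D, ∀ x, f n x ≤ D)
    (hev : ∀ᶠ n in atTop, ∀ x, f n x ≤ C * g n) :
    ∃ c, 0 < c ∧ ∀ n, 1 ≤ n → ∀ x, f n x ≤ c * g n := by
  obtain ⟨N, hN⟩ := eventually_atTop.1 hev
  choose D hD using hbdd
  have hsum : 0 ≤ ∑ k ∈ Finset.range N, |D k| / |g k| :=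
    Finset.sum_nonneg fun k _ => by positivity
  refine ⟨|C| + 1 + ∑ k ∈ Finset.range N, |D k| / |g k|, by positivity, fun n hn x => ?_⟩
  have hgn := hg n hn
  rcases le_or_gt N n with h | h
  · refine (hN n h x).trans (mul_le_mul_of_nonneg_right ?_ hgn.le)
    linarith [le_abs_self C]
  · have h1 : |D n| / |g n| ≤ ∑ k ∈ Finset.range N, |D k| / |g k| :=
      Finset.single_le_sum (f := fun k => |D k| / |g k|) (fun k _ => by positivity)
        (Finset.mem_range.2 h)
    calc f n x ≤ |D n| := (hD n x).trans (le_abs_self _)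
      _ = |D n| / |g n| * g n := by
          rw [abs_of_pos hgn]
          field_simp
      _ ≤ _ := mul_le_mul_of_nonneg_right (by linarith [abs_nonneg C]) hgn.le

theorem theorem1 (σ φ : ℝ → ℝ) (lσ lφ : ℝ≥0) (hσ : LipschitzWith lσ σ) (hφ : LipschitzWith lφ φ)
    (γ : ℝ) (hγ : 0 < γ) (p T : ℕ → ℕ) (X : ∀ n, Matrix (Fin (p n)) (Fin (T n)) ℝ)
    (hgrowth : RandomFeatures.GrowthRate p T X)
    {Ω : ℕ → Type*} [∀ n, MeasurableSpace (Ω n)] (P : ∀ n, Measure (Ω n))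
    [∀ n, IsProbabilityMeasure (P n)]
    (V : ∀ n, Ω n → Matrix (Fin n) (Fin (p n)) ℝ)
    (hV : ∀ n, RandomFeatures.IsGaussianMatrix (V n) (P n)) :
    (∀ n : ℕ, 1 ≤ n → RandomFeatures.Phi σ φ (X n) ≠ 0 →
      ∃! δ : ℝ, 0 < δ ∧ RandomFeatures.FixedPoint n γ (RandomFeatures.Phi σ φ (X n)) δ) ∧
    ∀ ε : ℝ, 0 < ε → ∃ c : ℝ, 0 < c ∧ ∀ n : ℕ, 1 ≤ n → ∀ δ : ℝ, 0 ≤ δ →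
      RandomFeatures.FixedPoint n γ (RandomFeatures.Phi σ φ (X n)) δ →
      ‖RandomFeatures.expectation (P n) (fun ω =>
            RandomFeatures.resolvent γ
              (RandomFeatures.featureMatrix σ ((V n ω).map φ) (X n)))
          - RandomFeatures.Qbar n γ (RandomFeatures.Phi σ φ (X n)) δ‖
        ≤ c * (n : ℝ) ^ (-(1 / 2 : ℝ) + ε) := by
  refine ⟨fun n _ h0 => existsUnique_fixedPoint hγ (posSemidef_Phi hσ hφ _) h0, fun ε hε => ?_⟩
  obtain ⟨a, b, C, hev⟩ := hgrowth.exists_bounds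
  set K : ℝ≥0 := lσ * C * lφ with hK
  set B : ℝ := 2 * (2 * σ 0 ^ 2 + 2 * (lσ * C) ^ 2 * (φ 0 ^ 2 * b)) + 2 * (lσ * C * lφ) ^ 2 * b
    with hB
  have hmain := exists_bound_of_eventually
    (ι := fun n => {δ : ℝ // 0 ≤ δ ∧
      RandomFeatures.FixedPoint n γ (RandomFeatures.Phi σ φ (X n)) δ})
    (f := fun n δ => ‖RandomFeatures.expectation (P n) (fun ω =>
            RandomFeatures.resolvent γ
              (RandomFeatures.featureMatrix σ ((V n ω).map φ) (X n)))
          - RandomFeatures.Qbar n γ (RandomFeatures.Phi σ φ (X n)) δ.1‖)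
    (g := fun n => (n : ℝ) ^ (-(1 / 2 : ℝ) + ε)) (C := |coreConst γ B a K|) ?_ ?_ ?_
  · obtain ⟨c, hc, h⟩ := hmain
    exact ⟨c, hc, fun n hn δ hδ hfix => h n hn ⟨δ, hδ, hfix⟩⟩
  · intro n hn
    have hn' : (0 : ℝ) < n := by exact_mod_cast hn
    exact Real.rpow_pos_of_pos hn' _
  · refine fun n => ⟨_, fun δ => (norm_sub_le _ _).trans (add_le_add_right
      (norm_Qbar_le (n := n) hγ (posSemidef_Phi hσ hφ (X n)) δ.2.1) _)⟩
  · filter_upwards [hev] with n hn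
    rintro ⟨δ, hδ, hfix⟩
    obtain ⟨hn0, hT, hna, hpb, hX⟩ := hn
    have hT' : (0 : ℝ) < T n := by exact_mod_cast hT
    have hn1 : (1 : ℝ) ≤ n := by exact_mod_cast hn0
    have htr : 1 / (T n : ℝ) * (secondMoment (featureMap σ φ (X n))).trace ≤ B := by
      rw [secondMoment_featureMap, one_div_mul_eq_div, div_le_iff₀ hT']
      have hp : (p n : ℝ) ≤ b * T n := (div_le_iff₀ hT').1 hpb
      calc _ ≤ _ := trace_Phi_le hσ hφ hX
        _ ≤ 2 * (2 * σ 0 ^ 2 * T n + 2 * (lσ * C) ^ 2 * (φ 0 ^ 2 * (b * T n))) +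
            2 * (lσ * C * lφ) ^ 2 * (b * T n) := by gcongr
        _ = _ := by
            rw [hB]
            ring
    simp only
    rw [expectation_resolvent_eq (hV n) hγ hT hσ hφ]
    rw [← secondMoment_featureMap] at hfix ⊢
    refine (norm_expectation_fullRes_sub_Qbar_fixedPoint_le hγ hT hn0
      (lipschitzWith_featureMap hσ hφ hX) htr hna hδ hfix).trans ?_
    -- the rate `n ^ (-1/2)` holds, which is stronger than the claim for every `ε > 0`
    have hrate : 1 / √(n : ℝ) ≤ (n : ℝ) ^ (-(1 / 2 : ℝ) + ε) := by
      rw [Real.sqrt_eq_rpow, one_div, ← Real.rpow_neg (by linarith)]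
      exact Real.rpow_le_rpow_of_exponent_le hn1 (by linarith)
    rw [div_eq_mul_one_div]
    exact mul_le_mul (le_abs_self _) hrate (by positivity) (abs_nonneg _)
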